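/- Let $A$ be an abelian variety over $\mathbb{Q}$ of dimension $g\ge 1$. For every integer $m\ge1$ fix a basis of $A[m]=A[m](\overline{\mathbb{Q}})$ over $\mathbb{Z}/m\mathbb{Z}$ with $2g$ elements, in such a way that for $m\mid n$ multiplication by $n/m$ maps the basis of $A[n]$ to that of $A[m]$. Let $\bar\rho_{A,m}:\mathrm{Gal}(\overline{\mathbb{Q}}/\mathbb{Q})\to \mathrm{GL}_{2g}(\mathbb{Z}/m\mathbb{Z})$ be the resulting representation on $A[m]$, let $\rho_A:\mathrm{Gal}(\overline{\mathbb{Q}}/\mathbb{Q})\to\mathrm{GL}_{2g}(\hat{\mathbb{Z}})$ be their inverse limit, and put $G(m)=\mathrm{Im}\,\bar\rho_{A,m}$. For a commutative ring $R$ let $\mathrm{GSp}_{2g}(R)$ be the group of $M\in\mathrm{GL}_{2g}(R)$ with $M^{t}JM=\mu J$ for some $\mu\in R^\times$, where $J=\begin{pmatrix}0&I_g\\-I_g&0\end{pmatrix}$. Assume that $\mathrm{Im}\,\rho_A$ is contained in, and is open in, $\mathrm{GSp}_{2g}(\hat{\mathbb{Z}})$. (If $A$ is principally polarized and the bases are symplectic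 for the Weil pairing, then the containment is automatic.) For $t\in\mathbb{Z}$ and $m\ge 1$ put $C(m,t)=\{M\in G(m):\mathrm{tr}\,M\equiv t \pmod m\}$, $$F_t(m)=\frac{m\,|C(m,t)|}{|G(m)|},\qquad H_t(m)=\frac{m\,|\{M\in\mathrm{GSp}_{2g}(\mathbb{Z}/m\mathbb{Z}):\mathrm{tr}\,M\equiv t \pmod m\}|}{|\mathrm{GSp}_{2g}(\mathbb{Z}/m\mathbb{Z})|}.$$ For $t\ne0$ let $v_\ell(t)$ denote the $\ell$-adic valuation of $t$. Below, $\ell$ runs over primes. (i) There is an integer $m\ge1$ such that $\mathrm{Im}\,\rho_A$ is the full preimage of $G(m)$ under the projection $\mathrm{GSp}_{2g}(\hat{\mathbb{Z}})\to\mathrm{GSp}_{2g}(\mathbb{Z}/m\mathbb{Z})$. Let $m_A$ be the least such integer. (ii) Let $m_1,m_2\ge1$ be integers such that every prime divisor of $m_1$ divides $m_A$ and $\gcd(m_2,m_A)=1$. Then the reduction maps give an isomorphism $G(m_1m_2)\cong G(m_1)\times G(m_2)$, and $G(m_2)=\mathrm{GSp}_{2g}(\mathbb{Z}/m_2\mathbb{Z})$.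 (iii) For every $t\in\mathbb{Z}$ the product $\prod_\ell H_t(\ell)$ converges, unconditionally and to a positive real number. If $t\neq0$, the same holds for $\prod_{\ell\nmid m_A}H_t(\ell^{v_\ell(t)+1})$. (iv) For every integer $t\ne0$, with $m_n=\prod_{\ell\le n}\ell^{n}$, $$\lim_{n\to\infty}F_t(m_n)=F_t\Big(m_A\prod_{\ell\mid m_A}\ell^{v_\ell(t)}\Big)\cdot\prod_{\ell\nmid m_A}H_t\big(\ell^{v_\ell(t)+1}\big).$$ -/

import Mathlib

open CategoryTheory AlgebraicGeometry

/-! ## The ring of profinite integers and the group of symplectic similitudes -/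

/-- The ring `Ẑ`, the inverse limit of the rings `ℤ/mℤ` over `m ≥ 1` ordered by divisibility,
with its profinite topology (induced by the product of the discrete topologies). -/
def ZHatSubring : Subring (∀ m : ℕ+, ZMod (m : ℕ)) where
  carrier := {x | ∀ (m n : ℕ+) (h : (m : ℕ) ∣ (n : ℕ)), ZMod.castHom h (ZMod (m : ℕ)) (x n) = x m}
  mul_mem' hx hy m n h := by simp only [Pi.mul_apply, map_mul, hx m n h, hy m n h]
  one_mem' m n h := by simp only [Pi.one_apply, map_one]
  add_mem' hx hy m n h := by simp only [Pi.add_apply, map_add, hx m n h, hy m n h]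
  zero_mem' m n h := by simp only [Pi.zero_apply, map_zero]
  neg_mem' hx m n h := by simp only [Pi.neg_apply, map_neg, hx m n h]

/-- `Ẑ` as a topological ring. -/
abbrev ZHat : Type := ZHatSubring

/-- The projection `Ẑ → ℤ/mℤ`. -/
def ZHat.proj (m : ℕ+) : ZHat →+* ZMod (m : ℕ) :=
  (Pi.evalRingHom (fun m : ℕ+ => ZMod (m : ℕ)) m).comp ZHatSubring.subtype

lemma ZHat.ext {x y : ZHat} (h : ∀ m, ZHat.proj m x = ZHat.proj m y) : x = y :=
  Subtype.ext (funext h)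

/-- The matrix `J` with blocks `0, I, -I, 0`. -/
def sympJ (g : ℕ) (R : Type*) [CommRing R] : Matrix (Fin g ⊕ Fin g) (Fin g ⊕ Fin g) R :=
  Matrix.fromBlocks 0 1 (-1) 0

/-- The general symplectic group: invertible `M` with `Mᵗ J M = μ J` for some unit `μ`. -/
def GSp (g : ℕ) (R : Type*) [CommRing R] : Subgroup (GL (Fin g ⊕ Fin g) R) where
  carrier := {M | ∃ μ : Rˣ, M.1.transpose * sympJ g R * M.1 = (μ : R) • sympJ g R}
  mul_mem' := by
    rintro M N ⟨μ, hμ⟩ ⟨ν, hν⟩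
    refine ⟨μ * ν, ?_⟩
    calc (M * N).1.transpose * sympJ g R * (M * N).1
        = N.1.transpose * (M.1.transpose * sympJ g R * M.1) * N.1 := by
          simp only [Units.val_mul, Matrix.transpose_mul, Matrix.mul_assoc]
      _ = ((μ * ν : Rˣ) : R) • sympJ g R := by
          rw [hμ, Matrix.mul_smul, Matrix.smul_mul, hν, smul_smul, Units.val_mul]
  one_mem' := ⟨1, by simp⟩
  inv_mem' := by
    rintro M ⟨μ, hμ⟩
    refine ⟨μ⁻¹, ?_⟩
    have h1 : M.1 * (M⁻¹).1 = 1 := by rw [← Units.val_mul, mul_inv_cancel, Units.val_one]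
    have h2 : (M⁻¹).1.transpose * M.1.transpose = 1 := by
      rw [← Matrix.transpose_mul, h1, Matrix.transpose_one]
    have h3 : (M⁻¹).1.transpose * (M.1.transpose * sympJ g R * M.1) * (M⁻¹).1 = sympJ g R := by
      calc _ = ((M⁻¹).1.transpose * M.1.transpose) * sympJ g R * (M.1 * (M⁻¹).1) := by
            simp only [Matrix.mul_assoc]
        _ = sympJ g R := by rw [h1, h2, Matrix.one_mul, Matrix.mul_one]
    rw [hμ, Matrix.mul_smul, Matrix.smul_mul] at h3
    rw [← h3, smul_smul, Units.inv_mul, one_smul, h3]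

/-! ## The Galois representations of an abelian variety over `ℚ` -/

open scoped MonObj

/-- A proper geometrically integral group scheme over a field is commutative. -/
instance abVarComm (A : Over (Spec (.of ℚ))) [GrpObj A] [IsProper A.hom]
    [GeometricallyIntegral A.hom] : IsCommMonObj A :=
  isCommMonObj_of_isProper_of_geometricallyIntegral A

/-- `Spec ℚ̄` as a scheme over `Spec ℚ`. -/
noncomputable def specQbar : Over (Spec (.of ℚ)) :=
  Over.mk (Spec.map (CommRingCat.ofHom (algebraMap ℚ (AlgebraicClosure ℚ))))

/-- The automorphism of `Spec ℚ̄` over `Spec ℚ` given by a Galois element. -/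
noncomputable def specGal (σ : Gal(AlgebraicClosure ℚ/ℚ)) : specQbar ⟶ specQbar :=
  Over.homMk (Spec.map (CommRingCat.ofHom (σ : AlgebraicClosure ℚ →+* AlgebraicClosure ℚ))) (by
    dsimp only [specQbar, Over.mk_hom]
    rw [← Spec.map_comp, ← CommRingCat.ofHom_comp]
    congr 2
    exact RingHom.ext fun x => σ.commutes x)

lemma specGal_one : specGal 1 = 𝟙 specQbar := by
  ext1
  exact Spec.map_id _

lemma specGal_mul (σ τ : Gal(AlgebraicClosure ℚ/ℚ)) :
    specGal (σ * τ) = specGal σ ≫ specGal τ := by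
  ext1
  exact Spec.map_comp
    (CommRingCat.ofHom (τ : AlgebraicClosure ℚ →+* AlgebraicClosure ℚ))
    (CommRingCat.ofHom (σ : AlgebraicClosure ℚ →+* AlgebraicClosure ℚ))

section AbVar

variable (A : Over (Spec (.of ℚ))) [GrpObj A]

/-- The group `A(ℚ̄)`, written additively. -/
abbrev QbarPoints : Type := Additive (specQbar ⟶ A)

/-- The action of a Galois element on `A(ℚ̄)`. -/
noncomputable def galPoints (σ : Gal(AlgebraicClosure ℚ/ℚ)) : QbarPoints A →+ QbarPoints A :=
  MonoidHom.toAdditive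
    { toFun := fun x : specQbar ⟶ A => specGal σ ≫ x
      map_one' := MonObj.comp_one _
      map_mul' := fun x y => MonObj.comp_mul _ x y }

lemma galPoints_one (x : QbarPoints A) : galPoints A 1 x = x := by
  change specGal 1 ≫ x.toMul = x.toMul
  rw [specGal_one, Category.id_comp]

lemma galPoints_mul (σ τ : Gal(AlgebraicClosure ℚ/ℚ)) (x : QbarPoints A) :
    galPoints A (σ * τ) x = galPoints A σ (galPoints A τ x) := by
  change specGal (σ * τ) ≫ x.toMul = specGal σ ≫ (specGal τ ≫ x.toMul)
  rw [specGal_mul, Category.assoc]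

variable [IsCommMonObj A]

/-- The group `A[m]` of `m`-torsion points in `A(ℚ̄)`. -/
noncomputable abbrev Tors (m : ℕ+) : AddSubgroup (QbarPoints A) :=
  AddSubgroup.torsionBy (QbarPoints A) ((m : ℕ) : ℤ)

noncomputable instance torsModule (m : ℕ+) : Module (ZMod (m : ℕ)) (Tors A m) :=
  AddSubgroup.torsionBy.zmodModule

variable {A} in
/-- The action of a Galois element on `A[m]`. -/
noncomputable def galTors (m : ℕ+) (σ : Gal(AlgebraicClosure ℚ/ℚ)) :
    Tors A m →ₗ[ZMod (m : ℕ)] Tors A m :=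
  AddMonoidHom.toZModLinearMap (m : ℕ)
    (((galPoints A σ).comp (Tors A m).subtype).codRestrict (Tors A m) fun x => by
      rw [AddSubgroup.torsionBy.nsmul_iff, ← map_nsmul]
      have h : (m : ℕ) • ((Tors A m).subtype x) = 0 :=
        AddSubgroup.torsionBy.nsmul_iff.mp x.2
      change galPoints A σ ((m : ℕ) • ((Tors A m).subtype x)) = 0
      rw [h, map_zero])

lemma coe_galTors (m : ℕ+) (σ : Gal(AlgebraicClosure ℚ/ℚ)) (x : Tors A m) :
    (galTors m σ x : QbarPoints A) = galPoints A σ x := rfl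

/-- A basis of the adelic Tate module of `A`, given by its reductions: for every `m ≥ 1`, a basis
of `A[m]` over `ℤ/mℤ` with `2g` elements, such that for `m ∣ n` multiplication by `n / m` maps the
basis of `A[n]` to that of `A[m]`. -/
structure TateBasis (g : ℕ) where
  basis : ∀ m : ℕ+, Module.Basis (Fin g ⊕ Fin g) (ZMod (m : ℕ)) (Tors A m)
  compat : ∀ m n : ℕ+, (m : ℕ) ∣ (n : ℕ) → ∀ i,
    ((n : ℕ) / (m : ℕ)) • (basis n i : QbarPoints A) = basis m i

namespace TateBasis

variable {A} {g : ℕ} (b : TateBasis A g)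

/-- The matrix of a Galois element acting on `A[m]`. -/
noncomputable def galMatrix (m : ℕ+) :
    Gal(AlgebraicClosure ℚ/ℚ) →* Matrix (Fin g ⊕ Fin g) (Fin g ⊕ Fin g) (ZMod (m : ℕ)) where
  toFun σ := LinearMap.toMatrix (b.basis m) (b.basis m) (galTors m σ)
  map_one' := by
    rw [← LinearMap.toMatrix_one (b.basis m)]
    congr 1
    ext1 x
    exact Subtype.ext (galPoints_one A x)
  map_mul' σ τ := by
    rw [← LinearMap.toMatrix_mul]
    congr 1
    ext1 x
    exact Subtype.ext (galPoints_mul A σ τ x)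

lemma galPoints_basis (m : ℕ+) (σ : Gal(AlgebraicClosure ℚ/ℚ)) (j : Fin g ⊕ Fin g) :
    galPoints A σ (b.basis m j) =
      ∑ i, (b.galMatrix m σ i j).val • (b.basis m i : QbarPoints A) := by
  have h := (b.basis m).sum_repr (galTors m σ (b.basis m j))
  rw [← coe_galTors, ← h, AddSubgroup.val_finsetSum]
  refine Finset.sum_congr rfl fun i _ => ?_
  rw [← LinearMap.toMatrix_apply]
  change ((b.galMatrix m σ i j • b.basis m i : Tors A m) : QbarPoints A) = _
  have hc : b.galMatrix m σ i j • b.basis m i =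
      (b.galMatrix m σ i j).val • b.basis m i := by
    rw [← Nat.cast_smul_eq_nsmul (ZMod (m : ℕ)), ZMod.natCast_rightInverse]
  rw [hc]
  rfl

lemma galMatrix_compat (m n : ℕ+) (hmn : (m : ℕ) ∣ (n : ℕ)) (σ : Gal(AlgebraicClosure ℚ/ℚ))
    (i j : Fin g ⊕ Fin g) :
    ZMod.castHom hmn (ZMod (m : ℕ)) (b.galMatrix n σ i j) = b.galMatrix m σ i j := by
  have key : galTors m σ (b.basis m j) =
      ∑ i, (ZMod.castHom hmn (ZMod (m : ℕ)) (b.galMatrix n σ i j)) • b.basis m i := by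
    apply Subtype.ext
    rw [coe_galTors, ← b.compat m n hmn j, map_nsmul, galPoints_basis, Finset.smul_sum,
      AddSubgroup.val_finsetSum]
    refine Finset.sum_congr rfl fun i _ => ?_
    rw [smul_comm, b.compat m n hmn i]
    have h : ZMod.castHom hmn (ZMod (m : ℕ)) (b.galMatrix n σ i j) =
        (((b.galMatrix n σ i j).val : ℕ) : ZMod (m : ℕ)) := by
      rw [ZMod.castHom_apply, ZMod.natCast_val]
    rw [h, Nat.cast_smul_eq_nsmul]
    rfl
  change _ = LinearMap.toMatrix (b.basis m) (b.basis m) (galTors m σ) i j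
  rw [LinearMap.toMatrix_apply, key, Module.Basis.repr_sum_self]

/-- The representation of the absolute Galois group on `A[m]`. -/
noncomputable def rhoMod (m : ℕ+) : Gal(AlgebraicClosure ℚ/ℚ) →* GL (Fin g ⊕ Fin g) (ZMod (m : ℕ)) :=
  (b.galMatrix m).toHomUnits

/-- The absolute Galois representation of `A`, the inverse limit of the representations on the
groups `A[m]`. -/
noncomputable def rho : Gal(AlgebraicClosure ℚ/ℚ) →* GL (Fin g ⊕ Fin g) ZHat :=
  MonoidHom.toHomUnits
    { toFun := fun σ => Matrix.of fun i j =>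
        ⟨fun m => b.galMatrix m σ i j, fun m n h => b.galMatrix_compat m n h σ i j⟩
      map_one' := by
        ext1 i j
        refine ZHat.ext fun m => ?_
        change b.galMatrix m 1 i j = _
        rw [map_one, Matrix.one_apply, Matrix.one_apply]
        split_ifs
        · exact (map_one (ZHat.proj m)).symm
        · exact (map_zero (ZHat.proj m)).symm
      map_mul' := fun σ τ => by
        ext1 i j
        refine ZHat.ext fun m => ?_
        change b.galMatrix m (σ * τ) i j = _
        rw [map_mul, Matrix.mul_apply, Matrix.mul_apply, map_sum]
        refine Finset.sum_congr rfl fun k _ => ?_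
        rw [map_mul]
        rfl }

/-- `G(m)`, the image of the representation on `A[m]`. -/
noncomputable def G (m : ℕ+) : Subgroup (GL (Fin g ⊕ Fin g) (ZMod (m : ℕ))) := (b.rhoMod m).range

end TateBasis

end AbVar

/-! ## Counting matrices with given trace -/

/-- `H_t(m) = m · #{M ∈ GSp_{2g}(ℤ/mℤ) : tr M ≡ t mod m} / #GSp_{2g}(ℤ/mℤ)`. -/
noncomputable def Hfun (g : ℕ) (t : ℤ) (m : ℕ) : ℝ :=
  (m : ℝ) * (Nat.card {M : GSp g (ZMod m) // Matrix.trace M.1.1 = (t : ZMod m)} : ℝ) /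
    (Nat.card (GSp g (ZMod m)) : ℝ)

namespace TateBasis

variable {A : Over (Spec (.of ℚ))} [GrpObj A] [IsCommMonObj A] {g : ℕ} (b : TateBasis A g)

/-- `C(m, t)`, the set of elements of `G(m)` of trace `t` modulo `m`. -/
def C (m : ℕ+) (t : ℤ) : Set (GL (Fin g ⊕ Fin g) (ZMod (m : ℕ))) :=
  {M | M ∈ b.G m ∧ Matrix.trace M.1 = (t : ZMod (m : ℕ))}

/-- `F_t(m) = m · #C(m, t) / #G(m)`. -/
noncomputable def Ffun (t : ℤ) (m : ℕ+) : ℝ :=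
  ((m : ℕ) : ℝ) * (Nat.card (b.C m t) : ℝ) / (Nat.card (b.G m) : ℝ)

/-- The image of the adelic representation is an open subgroup of `GSp_{2g}(Ẑ)`. -/
def HasOpenImage : Prop :=
  b.rho.range ≤ GSp g ZHat ∧
    IsOpen {M : GSp g ZHat | (M : GL (Fin g ⊕ Fin g) ZHat) ∈ b.rho.range}

/-- The image of the adelic representation is the full preimage in `GSp_{2g}(Ẑ)` of `G(m)`. -/
def IsLevel (m : ℕ+) : Prop :=
  ∀ M : GL (Fin g ⊕ Fin g) ZHat, M ∈ b.rho.range ↔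
    M ∈ GSp g ZHat ∧ Matrix.GeneralLinearGroup.map (ZHat.proj m) M ∈ b.G m

end TateBasis

/-- The integer `k · ∏_{ℓ ∣ k} ℓ ^ v_ℓ(t)`. -/
def twistLevel (k : ℕ+) (t : ℤ) : ℕ+ :=
  ⟨k * ∏ ℓ ∈ (k : ℕ).primeFactors, ℓ ^ padicValInt ℓ t,
    Nat.mul_pos k.pos (Finset.prod_pos fun _ h =>
      pow_pos (Nat.prime_of_mem_primeFactors h).pos _)⟩

/-- The integer `m_n = ∏_{ℓ ≤ n} ℓ ^ n`, the product being over primes. -/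
def mSeq (n : ℕ) : ℕ+ :=
  ⟨∏ ℓ ∈ (Finset.range (n + 1)).filter Nat.Prime, ℓ ^ n,
    Finset.prod_pos fun _ h => pow_pos (Finset.mem_filter.mp h).2.pos _⟩

section SympJ

variable {g : ℕ} {R S T : Type*} [CommRing R] [CommRing S] [CommRing T]

lemma sympJ_mul_self : sympJ g R * sympJ g R = -1 := by
  simp [sympJ, Matrix.fromBlocks_multiply, ← Matrix.fromBlocks_one, Matrix.fromBlocks_neg]

lemma sympJ_transpose : (sympJ g R).transpose = -sympJ g R := by
  simp [sympJ, Matrix.fromBlocks_transpose, Matrix.fromBlocks_neg]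

lemma sympJ_map (f : R →+* S) : (sympJ g R).map f = sympJ g S := by
  ext i j
  rcases i with i | i <;> rcases j with j | j <;> simp [sympJ, Matrix.one_apply, apply_ite f]

namespace GSp

lemma exists_coe_eq (M : Matrix (Fin g ⊕ Fin g) (Fin g ⊕ Fin g) R) (u : Rˣ)
    (h : M.transpose * sympJ g R * M = (u : R) • sympJ g R) : ∃ N ∈ GSp g R, N.1 = M := by
  have h1 : (-((u⁻¹ : Rˣ) : R) • (sympJ g R * M.transpose * sympJ g R)) * M = 1 := by
    calc _ = -((u⁻¹ : Rˣ) : R) • (sympJ g R * (M.transpose * sympJ g R * M)) := by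
          simp only [Matrix.smul_mul, Matrix.mul_assoc]
      _ = 1 := by
        rw [h, Matrix.mul_smul, sympJ_mul_self, smul_smul]
        simp
  exact ⟨⟨M, _, mul_eq_one_comm.mp h1, h1⟩, ⟨u, h⟩, rfl⟩

lemma map_mem (f : R →+* S) {M : GL (Fin g ⊕ Fin g) R} (hM : M ∈ GSp g R) :
    Matrix.GeneralLinearGroup.map f M ∈ GSp g S := by
  obtain ⟨u, hu⟩ := hM
  refine ⟨Units.map f u, ?_⟩
  have h := congrArg (fun X => X.map f) hu
  simp only [Matrix.map_mul, sympJ_map] at h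
  refine h.trans ?_
  ext i j
  simp [← sympJ_map f]

lemma scalar_mem (c : Rˣ) : Matrix.GeneralLinearGroup.scalar (Fin g ⊕ Fin g) c ∈ GSp g R := by
  refine ⟨c * c, ?_⟩
  change (Matrix.scalar _ (c : R)).transpose * sympJ g R * Matrix.scalar _ (c : R) = _
  ext i j
  simp [Matrix.mul_diagonal, Matrix.diagonal_mul]
  ring

/-- Elements of `GSp` over two rings glue along a bijection `R → S × T`. -/
lemma exists_map_eq_and_map_eq (f : R →+* S) (h : R →+* T) (hfh : Function.Bijective (f.prod h))
    {M : GL (Fin g ⊕ Fin g) S} (hM : M ∈ GSp g S) {N : GL (Fin g ⊕ Fin g) T}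
    (hN : N ∈ GSp g T) : ∃ P ∈ GSp g R, Matrix.GeneralLinearGroup.map f P = M ∧
      Matrix.GeneralLinearGroup.map h P = N := by
  obtain ⟨u, hu⟩ := hM
  obtain ⟨ν, hν⟩ := hN
  let e : R ≃+* S × T := RingEquiv.ofBijective (f.prod h) hfh
  have hf : ∀ x, f (e.symm x) = x.1 := fun x => congrArg Prod.fst (e.apply_symm_apply x)
  have hh : ∀ x, h (e.symm x) = x.2 := fun x => congrArg Prod.snd (e.apply_symm_apply x)
  have hext : ∀ x y : R, f x = f y → h x = h y → x = y := fun x y h1 h2 =>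
    hfh.1 (Prod.ext h1 h2)
  let P : Matrix (Fin g ⊕ Fin g) (Fin g ⊕ Fin g) R :=
    Matrix.of fun i j => e.symm (M.1 i j, N.1 i j)
  have hPf : P.map f = M.1 := by ext i j; simp [P, hf]
  have hPh : P.map h = N.1 := by ext i j; simp [P, hh]
  let κ : Rˣ := ⟨e.symm (u, ν), e.symm ((u⁻¹ : Sˣ), (ν⁻¹ : Tˣ)),
    by rw [← map_mul]; simp [← Prod.one_eq_mk], by rw [← map_mul]; simp [← Prod.one_eq_mk]⟩
  obtain ⟨Q, hQ, hQP⟩ := exists_coe_eq P κ (by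
    ext i j
    apply hext
    · have h1 : (P.transpose * sympJ g R * P).map f = ((κ : R) • sympJ g R).map f := by
        rw [Matrix.map_mul, Matrix.map_mul, sympJ_map, Matrix.transpose_map, hPf, hu,
          Matrix.map_smul' f _ _ (map_mul f), sympJ_map]
        congr 1
        exact (hf ((u : S), (ν : T))).symm
      exact congrFun (congrFun h1 i) j
    · have h1 : (P.transpose * sympJ g R * P).map h = ((κ : R) • sympJ g R).map h := by
        rw [Matrix.map_mul, Matrix.map_mul, sympJ_map, Matrix.transpose_map, hPh, hν,
          Matrix.map_smul' h _ _ (map_mul h), sympJ_map]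
        congr 1
        exact (hh ((u : S), (ν : T))).symm
      exact congrFun (congrFun h1 i) j)
  refine ⟨Q, hQ, Units.ext ?_, Units.ext ?_⟩
  · rw [← hPf, ← hQP]; rfl
  · rw [← hPh, ← hQP]; rfl

end GSp

/-- `MᵗJM` is alternating. -/
lemma transpose_mul_sympJ_mul_apply (M : Matrix (Fin g ⊕ Fin g) (Fin g ⊕ Fin g) R)
    (i j : Fin g ⊕ Fin g) : (M.transpose * sympJ g R * M) i j =
      ∑ k, (M (.inl k) i * M (.inr k) j - M (.inr k) i * M (.inl k) j) := by
  have h : (M.transpose * sympJ g R) i =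
      Sum.elim (fun k => -M (.inr k) i) (fun k => M (.inl k) i) := by
    ext k
    rcases k with k | k <;> simp [Matrix.mul_apply, sympJ, Matrix.one_apply]
  simp only [Matrix.mul_apply (M := M.transpose * sympJ g R), h, Fintype.sum_sum_type,
    Sum.elim_inl, Sum.elim_inr, ← Finset.sum_add_distrib]
  exact Finset.sum_congr rfl fun k _ => by ring

/-- An alternating matrix is `U - Uᵗ`, where `U` is its strictly upper triangular part. -/
lemma Matrix.exists_sub_transpose_eq {n : Type*} [Finite n] (E : Matrix n n R)
    (hd : ∀ i, E i i = 0) (ha : ∀ i j, E i j = -E j i) :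
    ∃ U : Matrix n n R, U - U.transpose = E ∧ ∀ i j, U i j = E i j ∨ U i j = 0 := by
  classical
  obtain ⟨m, ⟨e⟩⟩ := Finite.exists_equiv_fin n
  refine ⟨Matrix.of fun i j => if e i < e j then E i j else 0, ?_, fun i j => ?_⟩
  · ext i j
    simp only [Matrix.sub_apply, Matrix.of_apply, Matrix.transpose_apply]
    rcases lt_trichotomy (e i) (e j) with h | h | h
    · simp [h, h.not_gt]
    · simp [e.injective h, hd]
    · simp [h, h.not_gt, ha i j]
  · simp only [Matrix.of_apply]
    split_ifs <;> simp

/-- Elements of `GSp` lift along a surjection with square-zero kernel. -/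
lemma GSp.exists_map_eq_of_sq_zero (f : R →+* S) (hf : Function.Surjective f)
    (hI : ∀ x y, f x = 0 → f y = 0 → x * y = 0) {M : GL (Fin g ⊕ Fin g) S} (hM : M ∈ GSp g S) :
    ∃ N ∈ GSp g R, Matrix.GeneralLinearGroup.map f N = M := by
  obtain ⟨u, hu⟩ := hM
  obtain ⟨a, ha⟩ := hf u
  obtain ⟨a', ha'⟩ := hf ((u⁻¹ : Sˣ) : S)
  have hε : (a * a' - 1) * (a * a' - 1) = 0 := by
    apply hI <;> simp [ha, ha']
  let ν : Rˣ := ⟨a, a' * (2 - a * a'), by linear_combination -hε, by linear_combination -hε⟩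
  let L : Matrix (Fin g ⊕ Fin g) (Fin g ⊕ Fin g) R := Matrix.of fun i j => (hf (M.1 i j)).choose
  have hL : L.map f = M.1 := by
    ext i j; exact (hf (M.1 i j)).choose_spec
  set E := L.transpose * sympJ g R * L - a • sympJ g R with hE
  have hEf : E.map f = 0 := by
    rw [hE, Matrix.map_sub f (map_sub f), Matrix.map_mul, Matrix.map_mul, sympJ_map,
      Matrix.transpose_map, hL, hu, Matrix.map_smul' f _ _ (map_mul f), sympJ_map, ha, sub_self]
  have hEd : ∀ i, E i i = 0 := fun i => by
    rw [hE, Matrix.sub_apply, transpose_mul_sympJ_mul_apply,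
      Finset.sum_eq_zero fun k _ => by ring]
    rcases i with i | i <;> simp [sympJ]
  have hEa : ∀ i j, E i j = -E j i := fun i j => by
    have h1 : sympJ g R i j = -sympJ g R j i := by
      have := congrFun (congrFun (sympJ_transpose (g := g) (R := R)) j) i
      simpa using this
    rw [hE, Matrix.sub_apply, Matrix.sub_apply, transpose_mul_sympJ_mul_apply,
      transpose_mul_sympJ_mul_apply, neg_sub, Matrix.smul_apply, Matrix.smul_apply, h1, smul_neg,
      sub_neg_eq_add, sub_eq_add_neg, add_comm, ← Finset.sum_neg_distrib]
    exact congrArg₂ _ rfl (Finset.sum_congr rfl fun k _ => by ring)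
  obtain ⟨U, hU, hU0⟩ := Matrix.exists_sub_transpose_eq E hEd hEa
  have hUf : ∀ i j, f (U i j) = 0 := fun i j => by
    rcases hU0 i j with h | h
    · rw [h]; exact congrFun (congrFun hEf i) j
    · rw [h, map_zero]
  have hmul : ∀ P Q : Matrix (Fin g ⊕ Fin g) (Fin g ⊕ Fin g) R, P.map f = 0 → Q.map f = 0 →
      P * Q = 0 := fun P Q hP hQ => by
    ext i j
    rw [Matrix.mul_apply]
    exact Finset.sum_eq_zero fun k _ =>
      hI _ _ (congrFun (congrFun hP i) k) (congrFun (congrFun hQ k) j)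
  set Y := -((ν⁻¹ : Rˣ) : R) • U with hY
  set X := -(sympJ g R * Y) with hX
  have hYf : Y.map f = 0 := by
    ext i j; simp [hY, hUf]
  have hXf : X.map f = 0 := by
    rw [hX, Matrix.map_neg f (map_neg f), Matrix.map_mul, hYf, Matrix.mul_zero, neg_zero]
  have hJX : sympJ g R * X = Y := by
    rw [hX, Matrix.mul_neg, ← Matrix.mul_assoc, sympJ_mul_self]; simp
  have hXJ : X.transpose * sympJ g R = -Y.transpose := by
    rw [← hJX, Matrix.transpose_mul, sympJ_transpose, Matrix.mul_neg, neg_neg]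
  have hLE : L.transpose * sympJ g R * L = a • sympJ g R + E := by rw [hE]; abel
  obtain ⟨N, hN, hNL⟩ := GSp.exists_coe_eq (L * (1 + X)) ν (by
    have h1 : X.transpose * E = 0 := hmul _ _ (by rw [Matrix.transpose_map, hXf]; rfl) hEf
    have h2 : E * X = 0 := hmul _ _ hEf hXf
    have h3 : Y.transpose * X = 0 := hmul _ _ (by rw [Matrix.transpose_map, hYf]; rfl) hXf
    have h4 : a • (Y - Y.transpose) = -E := by
      rw [← hU, hY, Matrix.transpose_smul, ← smul_sub, smul_smul,
        show a * -((ν⁻¹ : Rˣ) : R) = -1 by rw [mul_neg]; exact congrArg _ ν.mul_inv,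
        neg_one_smul]
    calc (L * (1 + X)).transpose * sympJ g R * (L * (1 + X))
        = (1 + X.transpose) * (L.transpose * sympJ g R * L) * (1 + X) := by
          simp only [Matrix.transpose_mul, Matrix.transpose_add, Matrix.transpose_one,
            Matrix.mul_assoc]
      _ = a • (sympJ g R + sympJ g R * X + X.transpose * sympJ g R
            + X.transpose * sympJ g R * X) + (E + E * X + X.transpose * E
            + X.transpose * E * X) := by
          rw [hLE]
          simp only [add_mul, mul_add, one_mul, mul_one, smul_add, Matrix.smul_mul,
            Matrix.mul_smul]
          abel
      _ = a • sympJ g R + a • (Y - Y.transpose) + E := by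
          rw [h1, h2, hXJ, hJX, Matrix.neg_mul, h3]
          simp only [smul_add, smul_sub, smul_neg, neg_zero, zero_mul, add_zero]
          abel
      _ = (ν : R) • sympJ g R := by rw [h4]; simp [ν])
  refine ⟨N, hN, Units.ext ?_⟩
  change N.1.map f = M.1
  rw [hNL, Matrix.map_mul, hL, Matrix.map_add f (map_add f), hXf, Matrix.map_one f (map_zero f)
    (map_one f), add_zero, mul_one]

end SympJ

section Lifting

open Matrix.GeneralLinearGroup (map)

variable {g : ℕ}

lemma ZMod.castHom_prod_castHom_bijective {a b n : ℕ} (hab : Nat.Coprime a b) (hn : n = a * b)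
    (ha : a ∣ n) (hb : b ∣ n) :
    Function.Bijective ((ZMod.castHom ha (ZMod a)).prod (ZMod.castHom hb (ZMod b))) := by
  subst hn
  have h : (ZMod.castHom ha (ZMod a)).prod (ZMod.castHom hb (ZMod b)) =
      (ZMod.chineseRemainder hab : ZMod (a * b) →+* ZMod a × ZMod b) := Subsingleton.elim _ _
  rw [h]
  exact (ZMod.chineseRemainder hab).bijective

lemma ZMod.castHom_eq_zero_iff_exists {m n : ℕ} (h : m ∣ n) (x : ZMod n) :
    ZMod.castHom h (ZMod m) x = 0 ↔ ∃ y, x = m * y := by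
  constructor
  · obtain ⟨z, rfl⟩ := ZMod.intCast_surjective x
    intro hz
    rw [map_intCast, ZMod.intCast_zmod_eq_zero_iff_dvd] at hz
    obtain ⟨w, rfl⟩ := hz
    exact ⟨w, by push_cast; rfl⟩
  · rintro ⟨y, rfl⟩
    rw [map_mul, map_natCast, ZMod.natCast_self, zero_mul]

lemma ZMod.castHom_castHom {k m n : ℕ} (h : k ∣ m) (h' : m ∣ n) (x : ZMod n) :
    ZMod.castHom h (ZMod k) (ZMod.castHom h' (ZMod m) x) =
      ZMod.castHom (h.trans h') (ZMod k) x :=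
  congrFun (congrArg DFunLike.coe (Subsingleton.elim
    ((ZMod.castHom h (ZMod k)).comp (ZMod.castHom h' (ZMod m)))
    (ZMod.castHom (h.trans h') (ZMod k)))) x

lemma Matrix.GeneralLinearGroup.map_castHom_map_castHom {α : Type*} [Fintype α] [DecidableEq α]
    {k m n : ℕ} (h : k ∣ m) (h' : m ∣ n) (M : GL α (ZMod n)) :
    map (ZMod.castHom h (ZMod k)) (map (ZMod.castHom h' (ZMod m)) M) =
      map (ZMod.castHom (h.trans h') (ZMod k)) M :=
  Units.ext <| Matrix.ext fun i j => ZMod.castHom_castHom h h' (M.1 i j)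

namespace GSp

/-- Reduction `GSp(ℤ/n) → GSp(ℤ/m)` is surjective. -/
lemma exists_map_castHom_eq {m n : ℕ} (hmn : m ∣ n) (hn : n ≠ 0)
    {M : GL (Fin g ⊕ Fin g) (ZMod m)} (hM : M ∈ GSp g (ZMod m)) :
    ∃ N ∈ GSp g (ZMod n), map (ZMod.castHom hmn (ZMod m)) N = M := by
  obtain ⟨d, hd⟩ := id hmn
  induction d using Nat.recOnMul generalizing m n with
  | zero => simp [hd] at hn
  | one =>
    rw [mul_one] at hd
    subst hd
    exact ⟨M, hM, by rw [Subsingleton.elim (ZMod.castHom hmn (ZMod n)) (RingHom.id _)]; simp⟩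
  | prime p hp =>
    by_cases hpm : p ∣ m
    · refine exists_map_eq_of_sq_zero _ (ZMod.castHom_surjective hmn) (fun x y hx hy => ?_) hM
      obtain ⟨x, rfl⟩ := (ZMod.castHom_eq_zero_iff_exists hmn x).mp hx
      obtain ⟨y, rfl⟩ := (ZMod.castHom_eq_zero_iff_exists hmn y).mp hy
      have h0 : (m : ZMod n) * m = 0 := by
        rw [← Nat.cast_mul, ZMod.natCast_eq_zero_iff, hd]
        exact mul_dvd_mul_left m hpm
      linear_combination x * y * h0
    · have hc : Nat.Coprime m p := ((Nat.Prime.coprime_iff_not_dvd hp).mpr hpm).symm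
      obtain ⟨N, hN, h, -⟩ := exists_map_eq_and_map_eq _ _
        (ZMod.castHom_prod_castHom_bijective hc hd hmn (Dvd.intro_left m hd.symm)) hM
        (one_mem (GSp g (ZMod p)))
      exact ⟨N, hN, h⟩
  | mul a b iha ihb =>
    have h1 : m ∣ m * a := Dvd.intro _ rfl
    have h2 : m * a ∣ n := ⟨b, by rw [hd, mul_assoc]⟩
    obtain ⟨N, hN, hNM⟩ := iha h1 (ne_zero_of_dvd_ne_zero hn h2) hM rfl
    obtain ⟨P, hP, hPN⟩ := ihb h2 hn hN (by rw [hd, mul_assoc])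
    exact ⟨P, hP, by rw [← hNM, ← hPN, Matrix.GeneralLinearGroup.map_castHom_map_castHom]⟩

end GSp

lemma ZHat.castHom_proj {m n : ℕ+} (h : (m : ℕ) ∣ n) (x : ZHat) :
    ZMod.castHom h (ZMod (m : ℕ)) (ZHat.proj n x) = ZHat.proj m x := x.2 m n h

lemma ZHat.map_castHom_map_proj {m n : ℕ+} (h : (m : ℕ) ∣ n) (M : GL (Fin g ⊕ Fin g) ZHat) :
    map (ZMod.castHom h (ZMod (m : ℕ))) (map (ZHat.proj n) M) = map (ZHat.proj m) M :=
  Units.ext <| Matrix.ext fun i j => ZHat.castHom_proj h (M.1 i j)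

lemma ZHat.isUnit_of_forall_proj {x : ZHat} (h : ∀ m, IsUnit (ZHat.proj m x)) : IsUnit x := by
  choose v hv using fun m => (h m).exists_right_inv
  have hc : ∀ (m n : ℕ+) (h : (m : ℕ) ∣ (n : ℕ)), ZMod.castHom h (ZMod (m : ℕ)) (v n) = v m := by
    intro m n hmn
    have h1 := congrArg (ZMod.castHom hmn (ZMod (m : ℕ))) (hv n)
    rw [map_mul, ZHat.castHom_proj, map_one] at h1
    linear_combination (v m) * h1 - ZMod.castHom hmn (ZMod (m : ℕ)) (v n) * hv m
  exact IsUnit.of_mul_eq_one (⟨v, hc⟩ : ZHat) (ZHat.ext fun m => by rw [map_mul, map_one]; exact hv m)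

lemma GSp.exists_zHat_of_compat (hg : 1 ≤ g) (N : ∀ m : ℕ+, GL (Fin g ⊕ Fin g) (ZMod (m : ℕ)))
    (hN : ∀ m : ℕ+, N m ∈ GSp g (ZMod (m : ℕ)))
    (hc : ∀ (m n : ℕ+) (h : (m : ℕ) ∣ (n : ℕ)), map (ZMod.castHom h (ZMod (m : ℕ))) (N n) = N m) :
    ∃ M ∈ GSp g ZHat, ∀ m, map (ZHat.proj m) M = N m := by
  let L : Matrix (Fin g ⊕ Fin g) (Fin g ⊕ Fin g) ZHat := Matrix.of fun i j =>
    ⟨fun m => (N m).1 i j, fun m n h => congrArg (fun X => X.1 i j) (hc m n h)⟩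
  have hL : ∀ m, L.map (ZHat.proj m) = (N m).1 := fun m => rfl
  choose u hu using hN
  have hE : ∀ m, (L.transpose * sympJ g ZHat * L).map (ZHat.proj m) =
      ((u m : (ZMod (m : ℕ))ˣ) : ZMod (m : ℕ)) • sympJ g (ZMod (m : ℕ)) := fun m => by
    rw [Matrix.map_mul, Matrix.map_mul, sympJ_map, Matrix.transpose_map, hL, hu]
  let i₀ : Fin g := ⟨0, hg⟩
  have ha : ∀ m, ZHat.proj m ((L.transpose * sympJ g ZHat * L) (.inl i₀) (.inr i₀)) = u m :=
    fun m => by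
      have := congrFun (congrFun (hE m) (.inl i₀)) (.inr i₀)
      rw [Matrix.map_apply] at this
      rw [this]
      simp [sympJ]
  obtain ⟨a, ha'⟩ := ZHat.isUnit_of_forall_proj fun m => (ha m).symm ▸ (u m).isUnit
  obtain ⟨M, hM, hML⟩ := GSp.exists_coe_eq L a (by
    ext1 i j
    refine ZHat.ext fun m => ?_
    have h1 := congrFun (congrFun (hE m) i) j
    rw [Matrix.map_apply] at h1
    change _ = ZHat.proj m (a * sympJ g ZHat i j)
    rw [h1, map_mul, ha', ha, ← sympJ_map (ZHat.proj m)]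
    rfl)
  exact ⟨M, hM, fun m => Units.ext (by rw [← hL, ← hML]; rfl)⟩

/-- Reduction `GSp(Ẑ) → GSp(ℤ/n)` is surjective. -/
lemma GSp.exists_map_proj_eq (hg : 1 ≤ g) (n : ℕ+) {M : GL (Fin g ⊕ Fin g) (ZMod (n : ℕ))}
    (hM : M ∈ GSp g (ZMod (n : ℕ))) : ∃ N ∈ GSp g ZHat, map (ZHat.proj n) N = M := by
  have hne : ∀ k : ℕ, (n : ℕ) * k.factorial ≠ 0 := fun k => mul_ne_zero n.ne_zero k.factorial_ne_zero
  have hdvd : ∀ {j k : ℕ}, j ≤ k → (n : ℕ) * j.factorial ∣ n * k.factorial := fun h =>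
    mul_dvd_mul_left _ (Nat.factorial_dvd_factorial h)
  choose! lift hlift hlift' using fun (k : ℕ) (X : GL (Fin g ⊕ Fin g) (ZMod (n * k.factorial)))
    (hX : X ∈ GSp g (ZMod (n * k.factorial))) =>
    GSp.exists_map_castHom_eq (hdvd k.le_succ) (hne (k + 1)) hX
  obtain ⟨X₀, hX₀, hX₀M⟩ := GSp.exists_map_castHom_eq (Dvd.intro _ rfl) (hne 0) hM
  let s : ∀ k : ℕ, GL (Fin g ⊕ Fin g) (ZMod (n * k.factorial)) :=
    fun k => Nat.rec X₀ (fun k X => lift k X) k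
  have hs : ∀ k, s k ∈ GSp g _ := fun k => by
    induction k with
    | zero => exact hX₀
    | succ k ih => exact hlift k _ ih
  have hsc : ∀ (j k : ℕ) (h : j ≤ k), map (ZMod.castHom (hdvd h) _) (s k) = s j := by
    intro j k h
    induction k, h using Nat.le_induction with
    | base => rw [Subsingleton.elim (ZMod.castHom _ _) (RingHom.id _)]; simp
    | succ k h ih =>
      rw [← ih, ← hlift' k (s k) (hs k), Matrix.GeneralLinearGroup.map_castHom_map_castHom]
  have hm : ∀ m : ℕ+, (m : ℕ) ∣ n * (m : ℕ).factorial := fun m =>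
    (Nat.dvd_factorial m.pos le_rfl).mul_left _
  obtain ⟨N, hN, hNm⟩ := GSp.exists_zHat_of_compat hg
    (fun m => map (ZMod.castHom (hm m) _) (s m)) (fun m => GSp.map_mem _ (hs m))
    (fun m k h => by
      rw [← hsc m k (Nat.le_of_dvd k.pos h), Matrix.GeneralLinearGroup.map_castHom_map_castHom,
        Matrix.GeneralLinearGroup.map_castHom_map_castHom])
  refine ⟨N, hN, ?_⟩
  rw [hNm, ← hX₀M]
  change _ = Matrix.GeneralLinearGroup.map _ (s 0)
  rw [← hsc 0 n (Nat.zero_le _), Matrix.GeneralLinearGroup.map_castHom_map_castHom]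

/-- Elements of `GSp` at coprime levels lift simultaneously to `GSp(Ẑ)`. -/
lemma GSp.exists_map_proj_eq_and_map_proj_eq (hg : 1 ≤ g) {m n : ℕ+} (hmn : Nat.Coprime m n)
    {M : GL (Fin g ⊕ Fin g) (ZMod (m : ℕ))} (hM : M ∈ GSp g (ZMod (m : ℕ)))
    {N : GL (Fin g ⊕ Fin g) (ZMod (n : ℕ))} (hN : N ∈ GSp g (ZMod (n : ℕ))) :
    ∃ P ∈ GSp g ZHat, map (ZHat.proj m) P = M ∧ map (ZHat.proj n) P = N := by
  have h1 : (m : ℕ) ∣ (m * n : ℕ+) := Dvd.intro _ (PNat.mul_coe m n).symm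
  have h2 : (n : ℕ) ∣ (m * n : ℕ+) := Dvd.intro_left _ (PNat.mul_coe m n).symm
  obtain ⟨Q, hQ, hQM, hQN⟩ := GSp.exists_map_eq_and_map_eq _ _
    (ZMod.castHom_prod_castHom_bijective hmn (PNat.mul_coe m n) h1 h2) hM hN
  obtain ⟨P, hP, hPQ⟩ := GSp.exists_map_proj_eq hg _ hQ
  exact ⟨P, hP, by rw [← hQM, ← hPQ, ZHat.map_castHom_map_proj],
    by rw [← hQN, ← hPQ, ZHat.map_castHom_map_proj]⟩

end Lifting

section Topology

lemma ZHat.exists_forall_proj_eq_mem {x : ZHat} {U : Set ZHat} (hU : U ∈ nhds x) :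
    ∃ m : ℕ+, ∀ y, ZHat.proj m y = ZHat.proj m x → y ∈ U := by
  rw [nhds_induced, Filter.mem_comap] at hU
  obtain ⟨V, hV, hVU⟩ := hU
  rw [nhds_pi, Filter.mem_pi] at hV
  obtain ⟨I, hI, t, ht, htV⟩ := hV
  refine ⟨∏ m ∈ hI.toFinset, m, fun y hy => hVU (htV fun i hi => ?_)⟩
  have hd : (i : ℕ) ∣ ((∏ m ∈ hI.toFinset, m : ℕ+) : ℕ) :=
    PNat.dvd_iff.mp (Finset.dvd_prod_of_mem _ (hI.mem_toFinset.mpr hi))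
  have h : ZHat.proj i y = ZHat.proj i x := by
    rw [← ZHat.castHom_proj hd, hy, ZHat.castHom_proj]
  change ZHat.proj i y ∈ t i
  rw [h]
  exact mem_of_mem_nhds (ht i)

lemma ZHat.exists_forall_forall_proj_eq_mem {α : Type*} [Finite α] {M : α → α → ZHat}
    {U : Set (α → α → ZHat)} (hU : U ∈ nhds M) :
    ∃ m : ℕ+, ∀ N : α → α → ZHat, (∀ i j, ZHat.proj m (N i j) = ZHat.proj m (M i j)) → N ∈ U := by
  have : Fintype α := Fintype.ofFinite α
  rw [nhds_pi, Filter.mem_pi'] at hU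
  obtain ⟨I, t, ht, htU⟩ := hU
  have h1 : ∀ i, ∃ m : ℕ+, ∀ v : α → ZHat, (∀ j, ZHat.proj m (v j) = ZHat.proj m (M i j)) →
      v ∈ t i := fun i => by
    have h := ht i
    rw [nhds_pi, Filter.mem_pi'] at h
    obtain ⟨I', t', ht', htU'⟩ := h
    choose m hm using fun j => ZHat.exists_forall_proj_eq_mem (ht' j)
    refine ⟨∏ j, m j, fun v hv => htU' fun j _ => hm j _ ?_⟩
    have hd : (m j : ℕ) ∣ ((∏ j, m j : ℕ+) : ℕ) :=
      PNat.dvd_iff.mp (Finset.dvd_prod_of_mem _ (Finset.mem_univ j))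
    rw [← ZHat.castHom_proj hd, hv, ZHat.castHom_proj]
  choose m hm using h1
  refine ⟨∏ j, m j, fun N hN => htU fun i _ => hm i _ fun j => ?_⟩
  have hd : (m i : ℕ) ∣ ((∏ j, m j : ℕ+) : ℕ) :=
    PNat.dvd_iff.mp (Finset.dvd_prod_of_mem _ (Finset.mem_univ i))
  rw [← ZHat.castHom_proj hd, hN, ZHat.castHom_proj]

/-- The principal congruence subgroups form a basis of neighbourhoods of `1` in `GL(Ẑ)`. -/
lemma ZHat.exists_forall_map_proj_eq_one_mem {α : Type*} [Fintype α] [DecidableEq α]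
    {U : Set (GL α ZHat)} (hU : U ∈ nhds 1) :
    ∃ m : ℕ+, ∀ M : GL α ZHat, Matrix.GeneralLinearGroup.map (ZHat.proj m) M = 1 → M ∈ U := by
  rw [nhds_induced, Filter.mem_comap] at hU
  obtain ⟨V, hV, hVU⟩ := hU
  rw [map_one, Prod.one_eq_mk, mem_nhds_prod_iff] at hV
  obtain ⟨V₁, hV₁, V₂, hV₂, hV⟩ := hV
  have hV₂' : MulOpposite.op ⁻¹' V₂ ∈ nhds (1 : Matrix α α ZHat) :=
    MulOpposite.continuous_op.continuousAt hV₂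
  obtain ⟨m, hm⟩ := ZHat.exists_forall_forall_proj_eq_mem hV₁
  obtain ⟨n, hn⟩ := ZHat.exists_forall_forall_proj_eq_mem hV₂'
  have key : ∀ (k : ℕ+) (_ : (k : ℕ) ∣ (m * n : ℕ+)) (M : GL α ZHat),
      Matrix.GeneralLinearGroup.map (ZHat.proj (m * n)) M = 1 →
      ∀ i j, ZHat.proj k (M.1 i j) = ZHat.proj k ((1 : Matrix α α ZHat) i j) := by
    intro k hk M hM i j
    have h : ZHat.proj (m * n) (M.1 i j) = (1 : Matrix α α (ZMod ((m * n : ℕ+) : ℕ))) i j :=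
      congrArg (fun X : GL α (ZMod ((m * n : ℕ+) : ℕ)) => X.1 i j) hM
    rw [← ZHat.castHom_proj hk, h, Matrix.one_apply, Matrix.one_apply]
    split_ifs
    · rw [map_one, map_one]
    · rw [map_zero, map_zero]
  refine ⟨m * n, fun M hM => hVU (hV ⟨hm _ (key m ?_ M hM), hn _ (key n ?_ M⁻¹ ?_)⟩)⟩
  · exact Dvd.intro _ (PNat.mul_coe m n).symm
  · exact Dvd.intro_left _ (PNat.mul_coe m n).symm
  · rw [map_inv, hM, inv_one]

end Topology

section Level

open Matrix.GeneralLinearGroup (map)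

namespace TateBasis

variable {A : Over (Spec (.of ℚ))} [GrpObj A] [IsCommMonObj A] {g : ℕ} {b : TateBasis A g}

lemma mem_G_iff {m : ℕ+} {X : GL (Fin g ⊕ Fin g) (ZMod (m : ℕ))} :
    X ∈ b.G m ↔ ∃ M ∈ b.rho.range, map (ZHat.proj m) M = X := by
  constructor
  · rintro ⟨s, rfl⟩
    exact ⟨_, ⟨s, rfl⟩, rfl⟩
  · rintro ⟨_, ⟨s, rfl⟩, rfl⟩
    exact ⟨s, rfl⟩

lemma map_castHom_mem_G {m n : ℕ+} (h : (m : ℕ) ∣ n) {X : GL (Fin g ⊕ Fin g) (ZMod (n : ℕ))}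
    (hX : X ∈ b.G n) : map (ZMod.castHom h (ZMod (m : ℕ))) X ∈ b.G m := by
  obtain ⟨M, hM, rfl⟩ := mem_G_iff.mp hX
  exact mem_G_iff.mpr ⟨M, hM, (ZHat.map_castHom_map_proj h M).symm⟩

lemma exists_map_castHom_eq_of_mem_G {m n : ℕ+} (h : (m : ℕ) ∣ n)
    {X : GL (Fin g ⊕ Fin g) (ZMod (m : ℕ))} (hX : X ∈ b.G m) :
    ∃ Y ∈ b.G n, map (ZMod.castHom h (ZMod (m : ℕ))) Y = X := by
  obtain ⟨M, hM, rfl⟩ := mem_G_iff.mp hX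
  exact ⟨_, mem_G_iff.mpr ⟨M, hM, rfl⟩, ZHat.map_castHom_map_proj h M⟩

lemma HasOpenImage.exists_isLevel (hb : b.HasOpenImage) : ∃ m, b.IsLevel m := by
  obtain ⟨hle, V, hV, hVH⟩ := hb
  have h1 : (1 : GL (Fin g ⊕ Fin g) ZHat) ∈ V := by
    have : (1 : GSp g ZHat) ∈ Subtype.val ⁻¹' V := by
      rw [hVH]
      exact one_mem b.rho.range
    exact this
  obtain ⟨m, hm⟩ := ZHat.exists_forall_map_proj_eq_one_mem (hV.mem_nhds h1)
  refine ⟨m, fun M => ⟨fun h => ⟨hle h, mem_G_iff.mpr ⟨M, h, rfl⟩⟩, fun ⟨hM, hMG⟩ => ?_⟩⟩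
  obtain ⟨N, hN, hNM⟩ := mem_G_iff.mp hMG
  have h2 : M * N⁻¹ ∈ V := hm _ (by rw [map_mul, map_inv, hNM, mul_inv_cancel])
  have h3 : (⟨M * N⁻¹, mul_mem hM (inv_mem (hle hN))⟩ : GSp g ZHat) ∈ Subtype.val ⁻¹' V := h2
  rw [hVH] at h3
  have h4 : M * N⁻¹ ∈ b.rho.range := h3
  simpa using mul_mem h4 hN

lemma IsLevel.mem_G_iff_of_dvd {k n : ℕ+} (hk : b.IsLevel k) (hg : 1 ≤ g) (h : (k : ℕ) ∣ n)
    {X : GL (Fin g ⊕ Fin g) (ZMod (n : ℕ))} :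
    X ∈ b.G n ↔ X ∈ GSp g (ZMod (n : ℕ)) ∧ map (ZMod.castHom h (ZMod (k : ℕ))) X ∈ b.G k := by
  constructor
  · intro hX
    refine ⟨?_, map_castHom_mem_G h hX⟩
    obtain ⟨M, hM, rfl⟩ := mem_G_iff.mp hX
    exact GSp.map_mem _ ((hk M).mp hM).1
  · rintro ⟨hX, hXG⟩
    obtain ⟨M, hM, rfl⟩ := GSp.exists_map_proj_eq hg n hX
    rw [ZHat.map_castHom_map_proj] at hXG
    exact mem_G_iff.mpr ⟨M, (hk M).mpr ⟨hM, hXG⟩, rfl⟩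

lemma IsLevel.exists_mem_range {k m n : ℕ+} (hk : b.IsLevel k) (hg : 1 ≤ g)
    (hc : Nat.Coprime (m * k : ℕ+) n) {X : GL (Fin g ⊕ Fin g) (ZMod (m : ℕ))} (hX : X ∈ b.G m)
    {Y : GL (Fin g ⊕ Fin g) (ZMod (n : ℕ))} (hY : Y ∈ GSp g (ZMod (n : ℕ))) :
    ∃ M ∈ b.rho.range, map (ZHat.proj m) M = X ∧ map (ZHat.proj n) M = Y := by
  have h1 : (m : ℕ) ∣ (m * k : ℕ+) := Dvd.intro _ (PNat.mul_coe m k).symm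
  have h2 : (k : ℕ) ∣ (m * k : ℕ+) := Dvd.intro_left _ (PNat.mul_coe m k).symm
  obtain ⟨N, hN, rfl⟩ := mem_G_iff.mp hX
  obtain ⟨M, hM, hMN, hMY⟩ := GSp.exists_map_proj_eq_and_map_proj_eq hg hc
    (GSp.map_mem (ZHat.proj (m * k)) ((hk N).mp hN).1) hY
  refine ⟨M, (hk M).mpr ⟨hM, ?_⟩, ?_, hMY⟩
  · rw [← ZHat.map_castHom_map_proj h2, hMN, ZHat.map_castHom_map_proj]
    exact ((hk N).mp hN).2
  · rw [← ZHat.map_castHom_map_proj h1, hMN, ZHat.map_castHom_map_proj]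

end TateBasis

end Level

section ProdEquiv

open Matrix.GeneralLinearGroup (map)

variable {α : Type*} [Fintype α] [DecidableEq α] {a b n : ℕ}

/-- A subgroup of `GL(ℤ/ab)` as a product of subgroups of `GL(ℤ/a)` and `GL(ℤ/b)`. -/
lemma exists_mulEquiv_prod_of_coprime (hab : Nat.Coprime a b) (hn : n = a * b) (ha : a ∣ n)
    (hb : b ∣ n) (Γ : Subgroup (GL α (ZMod n))) (Γa : Subgroup (GL α (ZMod a)))
    (Γb : Subgroup (GL α (ZMod b)))
    (hΓa : ∀ M ∈ Γ, map (ZMod.castHom ha (ZMod a)) M ∈ Γa)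
    (hΓb : ∀ M ∈ Γ, map (ZMod.castHom hb (ZMod b)) M ∈ Γb)
    (hΓ : ∀ X ∈ Γa, ∀ Y ∈ Γb, ∃ M ∈ Γ, map (ZMod.castHom ha (ZMod a)) M = X ∧
      map (ZMod.castHom hb (ZMod b)) M = Y) :
    ∃ e : Γ ≃* Γa × Γb, ∀ M : Γ,
      ((e M).1 : GL α (ZMod a)) = map (ZMod.castHom ha (ZMod a)) M.1 ∧
      ((e M).2 : GL α (ZMod b)) = map (ZMod.castHom hb (ZMod b)) M.1 := by
  let φ : Γ →* Γa × Γb := MonoidHom.prod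
    (((map (ZMod.castHom ha (ZMod a))).comp Γ.subtype).codRestrict Γa fun M => hΓa M.1 M.2)
    (((map (ZMod.castHom hb (ZMod b))).comp Γ.subtype).codRestrict Γb fun M => hΓb M.1 M.2)
  refine ⟨MulEquiv.ofBijective φ ⟨fun M N h => ?_, fun ⟨X, Y⟩ => ?_⟩, fun M => ⟨rfl, rfl⟩⟩
  · have h1 : map (ZMod.castHom ha (ZMod a)) M.1 = map (ZMod.castHom ha (ZMod a)) N.1 :=
      congrArg (fun x => x.1.1) h
    have h2 : map (ZMod.castHom hb (ZMod b)) M.1 = map (ZMod.castHom hb (ZMod b)) N.1 :=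
      congrArg (fun x => x.2.1) h
    refine Subtype.ext (Units.ext (Matrix.ext fun i j =>
      (ZMod.castHom_prod_castHom_bijective hab hn ha hb).1 (Prod.ext ?_ ?_)))
    · exact congrArg (fun X : GL α (ZMod a) => X.1 i j) h1
    · exact congrArg (fun X : GL α (ZMod b) => X.1 i j) h2
  · obtain ⟨M, hM, h1, h2⟩ := hΓ X.1 X.2 Y.1 Y.2
    exact ⟨⟨M, hM⟩, Prod.ext (Subtype.ext h1) (Subtype.ext h2)⟩

lemma Matrix.GeneralLinearGroup.trace_map {R S : Type*} [CommRing R] [CommRing S] (f : R →+* S)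
    (M : GL α R) : Matrix.trace (map f M).1 = f (Matrix.trace M.1) :=
  (AddMonoidHom.map_trace f M.1).symm

/-- The normalized proportion of elements of trace `t` in a subgroup of `GL(ℤ/n)`. -/
noncomputable def trDensity (Γ : Subgroup (GL α (ZMod n))) (t : ℤ) : ℝ :=
  (n : ℝ) * (Nat.card {M : Γ // Matrix.trace M.1.1 = (t : ZMod n)} : ℝ) / (Nat.card Γ : ℝ)

lemma trDensity_eq_mul (hab : Nat.Coprime a b) (hn : n = a * b) (ha : a ∣ n)
    (hb : b ∣ n) (Γ : Subgroup (GL α (ZMod n))) (Γa : Subgroup (GL α (ZMod a)))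
    (Γb : Subgroup (GL α (ZMod b)))
    (hΓa : ∀ M ∈ Γ, map (ZMod.castHom ha (ZMod a)) M ∈ Γa)
    (hΓb : ∀ M ∈ Γ, map (ZMod.castHom hb (ZMod b)) M ∈ Γb)
    (hΓ : ∀ X ∈ Γa, ∀ Y ∈ Γb, ∃ M ∈ Γ, map (ZMod.castHom ha (ZMod a)) M = X ∧
      map (ZMod.castHom hb (ZMod b)) M = Y) (t : ℤ) :
    trDensity Γ t = trDensity Γa t * trDensity Γb t := by
  obtain ⟨e, he⟩ := exists_mulEquiv_prod_of_coprime hab hn ha hb Γ Γa Γb hΓa hΓb hΓ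
  have h1 : Nat.card Γ = Nat.card Γa * Nat.card Γb := by
    rw [← Nat.card_prod]
    exact Nat.card_congr e.toEquiv
  have h2 : Nat.card {M : Γ // Matrix.trace M.1.1 = (t : ZMod n)} =
      Nat.card {M : Γa // Matrix.trace M.1.1 = (t : ZMod a)} *
        Nat.card {M : Γb // Matrix.trace M.1.1 = (t : ZMod b)} := by
    rw [← Nat.card_prod, ← Nat.card_congr (Equiv.subtypeProdEquivProd
      (p := fun M : Γa => Matrix.trace M.1.1 = (t : ZMod a))
      (q := fun M : Γb => Matrix.trace M.1.1 = (t : ZMod b)))]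
    refine Nat.card_congr (Equiv.subtypeEquiv e.toEquiv fun M => ?_)
    change _ ↔ Matrix.trace (e M).1.1.1 = _ ∧ Matrix.trace (e M).2.1.1 = _
    rw [(he M).1, (he M).2, Matrix.GeneralLinearGroup.trace_map,
      Matrix.GeneralLinearGroup.trace_map]
    constructor
    · intro h
      rw [h, map_intCast, map_intCast]
      exact ⟨rfl, rfl⟩
    · rintro ⟨h, h'⟩
      refine (ZMod.castHom_prod_castHom_bijective hab hn ha hb).1 (Prod.ext ?_ ?_)
      · exact h.trans (map_intCast (ZMod.castHom ha (ZMod a)) t).symm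
      · exact h'.trans (map_intCast (ZMod.castHom hb (ZMod b)) t).symm
  rw [trDensity, trDensity, trDensity, h1, h2, hn]
  push_cast
  rw [div_mul_div_comm]
  ring

/-- Fibres of a surjective homomorphism all have the size of its kernel. -/
@[to_additive]
lemma MonoidHom.card_subtype_comp {G H : Type*} [Group G] [Group H] (φ : G →* H)
    (hφ : Function.Surjective φ) (P : H → Prop) :
    Nat.card {x // P (φ x)} = Nat.card {y // P y} * Nat.card φ.ker := by
  rw [← Nat.card_prod]
  refine Nat.card_congr (Equiv.trans (β := Σ y : {y : H // P y}, φ ⁻¹' {y.1})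
    ⟨fun x => ⟨⟨φ x, x.2⟩, ⟨x, rfl⟩⟩, fun z => ⟨z.2.1, ?_⟩, fun x => rfl, ?_⟩
    ((Equiv.sigmaCongrRight fun y : {y : H // P y} => φ.fiberEquivKerOfSurjective hφ y.1).trans
      (Equiv.sigmaEquivProd _ _)))
  · have : φ z.2.1 = z.1.1 := z.2.2
    rw [this]
    exact z.1.2
  · rintro ⟨⟨y, hy⟩, ⟨x, hx⟩⟩
    have hxy : φ x = y := hx
    subst hxy
    rfl

lemma Matrix.GeneralLinearGroup.trace_scalar_mul {R : Type*} [CommRing R] (c : Rˣ) (M : GL α R) :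
    Matrix.trace (scalar α c * M).1 = c * Matrix.trace M.1 := by
  change Matrix.trace (Matrix.diagonal (fun _ => (c : R)) * M.1) = _
  rw [← Matrix.smul_eq_diagonal_mul, Matrix.trace_smul, smul_eq_mul]

/-- The density is unchanged from level `k` to level `n` if scalars in the group act transitively
on the lifts of `t` modulo `k` to level `n`. -/
lemma trDensity_eq_of_scalar {k : ℕ} [NeZero n] (h : k ∣ n) (Γ : Subgroup (GL α (ZMod n)))
    (Γk : Subgroup (GL α (ZMod k)))
    (hmem : ∀ M ∈ Γ, map (ZMod.castHom h (ZMod k)) M ∈ Γk)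
    (hsurj : ∀ X ∈ Γk, ∃ M ∈ Γ, map (ZMod.castHom h (ZMod k)) M = X) (t : ℤ)
    (hsc : ∀ x : ZMod n, ZMod.castHom h (ZMod k) x = t → ∃ c : (ZMod n)ˣ,
      Matrix.GeneralLinearGroup.scalar α c ∈ Γ ∧ c * (t : ZMod n) = x) :
    trDensity Γ t = trDensity Γk t := by
  have : NeZero k := ⟨ne_zero_of_dvd_ne_zero (NeZero.ne n) h⟩
  let φ : Γ →* Γk :=
    ((map (ZMod.castHom h (ZMod k))).comp Γ.subtype).codRestrict Γk fun M => hmem M.1 M.2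
  have hφ : Function.Surjective φ := fun X => by
    obtain ⟨M, hM, h1⟩ := hsurj X.1 X.2
    exact ⟨⟨M, hM⟩, Subtype.ext h1⟩
  let f : ZMod n →+ ZMod k := (ZMod.castHom h (ZMod k)).toAddMonoidHom
  have hf : Function.Surjective f := ZMod.castHom_surjective h
  have c1 : n = k * Nat.card f.ker := by
    have := f.card_subtype_comp hf (fun _ => True)
    simpa using this
  have c2 : Nat.card {x : ZMod n // f x = t} = Nat.card f.ker := by
    have := f.card_subtype_comp hf (· = (t : ZMod k))
    simpa using this
  have c3 : Nat.card Γ = Nat.card Γk * Nat.card φ.ker := by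
    have := φ.card_subtype_comp hφ (fun _ => True)
    simpa only [Nat.card_congr (Equiv.subtypeUnivEquiv fun _ => trivial)] using this
  have c4 := φ.card_subtype_comp hφ (fun M => Matrix.trace M.1.1 = (t : ZMod k))
  choose c hcΓ hct using fun x : {x : ZMod n // f x = t} => hsc x.1 x.2
  have htr : ∀ M : Γ, Matrix.trace (φ M).1.1 = f (Matrix.trace M.1.1) := fun M =>
    Matrix.GeneralLinearGroup.trace_map _ M.1
  have c5 : Nat.card {M : Γ // Matrix.trace (φ M).1.1 = (t : ZMod k)} =
      Nat.card {x : ZMod n // f x = t} *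
        Nat.card {M : Γ // Matrix.trace M.1.1 = (t : ZMod n)} := by
    rw [← Nat.card_prod]
    let s : {x : ZMod n // f x = t} → Γ := fun x => ⟨_, hcΓ x⟩
    have hs : ∀ x (M : Γ), Matrix.trace (s x * M).1.1 = c x * Matrix.trace M.1.1 := fun x M =>
      Matrix.GeneralLinearGroup.trace_scalar_mul _ _
    have hs' : ∀ x (M : Γ), Matrix.trace ((s x)⁻¹ * M).1.1 =
        ((c x)⁻¹ : (ZMod n)ˣ) * Matrix.trace M.1.1 := fun x M => by
      rw [Units.eq_inv_mul_iff_mul_eq, ← hs, mul_inv_cancel_left]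
    symm
    refine Nat.card_congr ⟨fun p => ⟨s p.1 * p.2.1, ?_⟩,
      fun M => (⟨Matrix.trace M.1.1.1, ?_⟩, ⟨(s ⟨Matrix.trace M.1.1.1, ?_⟩)⁻¹ * M.1, ?_⟩), ?_, ?_⟩
    · rw [htr, hs, p.2.2, hct]
      exact p.1.2
    · rw [← htr]; exact M.2
    · rw [← htr]; exact M.2
    · rw [hs', Units.inv_mul_eq_iff_eq_mul, hct]
    · rintro ⟨x, M, hM⟩
      have h1 : Matrix.trace (s x * M).1.1 = x := by rw [hs, hM, hct]
      refine Prod.ext (Subtype.ext h1) (Subtype.ext ?_)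
      simp only [h1, Subtype.coe_eta, inv_mul_cancel_left]
    · rintro ⟨M, hM⟩
      exact Subtype.ext (mul_inv_cancel_left _ _)
  have hp1 : (0 : ℝ) < Nat.card φ.ker := Nat.cast_pos.mpr Nat.card_pos
  have hp2 : (0 : ℝ) < Nat.card Γk := Nat.cast_pos.mpr Nat.card_pos
  have h6 : (Nat.card f.ker : ℝ) * Nat.card {M : Γ // Matrix.trace M.1.1 = (t : ZMod n)} =
      Nat.card {M : Γk // Matrix.trace M.1.1 = (t : ZMod k)} * Nat.card φ.ker := by
    rw [← c2]
    exact_mod_cast c5.symm.trans c4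
  have c1' : (n : ℝ) = k * Nat.card f.ker := by exact_mod_cast c1
  rw [trDensity, trDensity, c3, c1', mul_assoc, h6]
  push_cast
  field_simp

end ProdEquiv

section Stability

open Matrix.GeneralLinearGroup (map)

lemma trDensity_eq_of_factorization {α : Type*} [Fintype α] [DecidableEq α] {k n q : ℕ} [NeZero n]
    (h : k ∣ n) (hq : q ∣ n) (hqn : n.primeFactors ⊆ q.primeFactors)
    (Γ : Subgroup (GL α (ZMod n))) (Γk : Subgroup (GL α (ZMod k)))
    (hmem : ∀ M ∈ Γ, map (ZMod.castHom h (ZMod k)) M ∈ Γk)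
    (hsurj : ∀ X ∈ Γk, ∃ M ∈ Γ, map (ZMod.castHom h (ZMod k)) M = X)
    {t : ℤ} {T : ℕ} {u : ℤ} (hk : k = q * T) (ht : t = T * u) (hu : IsCoprime u n)
    (hΓ : ∀ c : (ZMod n)ˣ, ZMod.castHom hq (ZMod q) c = 1 →
      Matrix.GeneralLinearGroup.scalar α c ∈ Γ) :
    trDensity Γ t = trDensity Γk t := by
  have hq0 : q ≠ 0 := ne_zero_of_dvd_ne_zero (NeZero.ne n) hq
  have hnil : IsNilpotent (q : ZMod n) := by
    obtain ⟨j, hj⟩ := (Nat.exists_dvd_pow_iff (NeZero.ne n) hq0).mpr hqn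
    exact ⟨j, by rw [← Nat.cast_pow]; exact (ZMod.natCast_eq_zero_iff _ _).mpr hj⟩
  obtain ⟨u', hu'⟩ := (ZMod.coe_int_isUnit_iff_isCoprime u n).mpr hu.symm
  refine trDensity_eq_of_scalar h Γ Γk hmem hsurj t fun x hx => ?_
  obtain ⟨y, hy⟩ := (ZMod.castHom_eq_zero_iff_exists h (x - t)).mp (by
    rw [map_sub, hx, map_intCast, sub_self])
  obtain ⟨c, hc⟩ := ((Commute.all (q : ZMod n) (y * ((u'⁻¹ : (ZMod n)ˣ) : ZMod n))).isNilpotent_mul_right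
    hnil).isUnit_one_add
  refine ⟨c, hΓ c ?_, ?_⟩
  · rw [hc, map_add, map_mul, map_natCast, map_one, ZMod.natCast_self, zero_mul, add_zero]
  · have h1 : (u : ZMod n) * ((u'⁻¹ : (ZMod n)ˣ) : ZMod n) = 1 := by rw [← hu', Units.mul_inv]
    have h2 : (t : ZMod n) = T * u := by rw [ht]; push_cast; rfl
    have h3 : (k : ZMod n) = q * T := by rw [hk]; push_cast; rfl
    rw [h3] at hy
    rw [hc]
    rw [h2] at hy ⊢
    linear_combination (q * y * T : ZMod n) * h1 - hy

lemma Hfun_eq_trDensity (g : ℕ) (t : ℤ) (m : ℕ) : Hfun g t m = trDensity (GSp g (ZMod m)) t := rfl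

lemma Hfun_mul {g : ℕ} {t : ℤ} {a b : ℕ} (hab : Nat.Coprime a b) :
    Hfun g t (a * b) = Hfun g t a * Hfun g t b :=
  trDensity_eq_mul hab rfl (Dvd.intro _ rfl) (Dvd.intro_left _ rfl) _ _ _
    (fun _ h => GSp.map_mem _ h) (fun _ h => GSp.map_mem _ h)
    (fun _ hX _ hY => GSp.exists_map_eq_and_map_eq _ _
      (ZMod.castHom_prod_castHom_bijective hab rfl _ _) hX hY) t

lemma Hfun_one (g : ℕ) (t : ℤ) : Hfun g t 1 = 1 := by
  have : Subsingleton (GL (Fin g ⊕ Fin g) (ZMod 1)) := Units.val_injective.subsingleton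
  have h : Nat.card {M : GSp g (ZMod 1) // Matrix.trace M.1.1 = (t : ZMod 1)} =
      Nat.card (GSp g (ZMod 1)) :=
    Nat.card_congr (Equiv.subtypeUnivEquiv fun _ => Subsingleton.elim _ _)
  rw [Hfun, h, Nat.card_of_subsingleton (1 : GSp g (ZMod 1))]
  simp

lemma Hfun_prod {g : ℕ} {t : ℤ} (s : Finset ℕ) (hs : ∀ p ∈ s, p.Prime) (n : ℕ) :
    Hfun g t (∏ p ∈ s, p ^ n) = ∏ p ∈ s, Hfun g t (p ^ n) := by
  induction s using Finset.induction_on with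
  | empty => simp [Hfun_one]
  | insert p s hp ih =>
    rw [Finset.prod_insert hp, Finset.prod_insert hp, Hfun_mul, ih fun q hq =>
      hs q (Finset.mem_insert_of_mem hq)]
    refine Nat.Coprime.prod_right fun q hq => Nat.Coprime.pow _ _ ?_
    exact (Nat.coprime_primes (hs p (Finset.mem_insert_self p s))
      (hs q (Finset.mem_insert_of_mem hq))).mpr fun h => hp (h ▸ hq)

lemma not_dvd_of_eq_pow_padicValInt_mul {p : ℕ} (hp : p.Prime) {t u : ℤ} (ht : t ≠ 0) {T : ℤ}
    (hT : (p : ℤ) ^ padicValInt p t ∣ T) (htu : t = T * u) : ¬ (p : ℤ) ∣ u := by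
  have : Fact p.Prime := ⟨hp⟩
  intro hpu
  have h : (p : ℤ) ^ (padicValInt p t + 1) ∣ t := by
    rw [pow_succ]
    exact (mul_dvd_mul hT hpu).trans (dvd_of_eq htu.symm)
  rw [padicValInt_dvd_iff] at h
  rcases h with h | h
  · exact ht h
  · omega

lemma Hfun_prime_pow {g : ℕ} {t : ℤ} (ht : t ≠ 0) {p : ℕ} (hp : p.Prime) {n : ℕ}
    (hn : padicValInt p t + 1 ≤ n) : Hfun g t (p ^ n) = Hfun g t (p ^ (padicValInt p t + 1)) := by
  have : NeZero (p ^ n) := ⟨pow_ne_zero _ hp.ne_zero⟩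
  have : Fact p.Prime := ⟨hp⟩
  obtain ⟨u, hu⟩ : (p : ℤ) ^ padicValInt p t ∣ t := padicValInt_dvd t
  have hpu := not_dvd_of_eq_pow_padicValInt_mul hp ht dvd_rfl hu
  refine trDensity_eq_of_factorization (q := p) (T := p ^ padicValInt p t) (u := u)
    (pow_dvd_pow p hn) (dvd_pow_self p (by omega)) ?_ _ _ (fun _ h => GSp.map_mem _ h)
    (fun _ h => GSp.exists_map_castHom_eq _ (NeZero.ne _) h) (pow_succ' _ _)
    (by push_cast; exact hu) ?_ fun c _ => GSp.scalar_mem c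
  · rw [Nat.primeFactors_pow _ (by omega)]
  · push_cast
    exact (((Nat.prime_iff_prime_int.mp hp).irreducible.coprime_iff_not_dvd).mpr hpu).symm.pow_right

lemma coe_twistLevel (k : ℕ+) (t : ℤ) :
    (twistLevel k t : ℕ) = k * ∏ p ∈ (k : ℕ).primeFactors, p ^ padicValInt p t := rfl

namespace TateBasis

variable {A : Over (Spec (.of ℚ))} [GrpObj A] [IsCommMonObj A] {g : ℕ} {b : TateBasis A g}

lemma Ffun_eq_trDensity (t : ℤ) (m : ℕ+) : b.Ffun t m = trDensity (b.G m) t := by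
  rw [Ffun, trDensity]
  congr 3
  exact Nat.card_congr (Equiv.subtypeSubtypeEquivSubtypeInter (· ∈ b.G m)
    (fun M => Matrix.trace M.1 = (t : ZMod (m : ℕ)))).symm

lemma IsLevel.Ffun_eq {k n : ℕ+} (hk : b.IsLevel k) (hg : 1 ≤ g) {t : ℤ} (ht : t ≠ 0)
    (h : (twistLevel k t : ℕ) ∣ n) (hn : (n : ℕ).primeFactors ⊆ (k : ℕ).primeFactors) :
    b.Ffun t n = b.Ffun t (twistLevel k t) := by
  have : NeZero (n : ℕ) := ⟨n.ne_zero⟩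
  have hkn : (k : ℕ) ∣ n := (Dvd.intro _ (coe_twistLevel k t).symm).trans h
  obtain ⟨u, hu⟩ : ((∏ p ∈ (k : ℕ).primeFactors, p ^ padicValInt p t : ℕ) : ℤ) ∣ t := by
    push_cast
    refine Finset.prod_dvd_of_coprime (fun p hp q hq hpq => ?_) fun p hp => ?_
    · refine IsCoprime.pow (Nat.isCoprime_iff_coprime.mpr ?_)
      exact (Nat.coprime_primes (Nat.prime_of_mem_primeFactors hp)
        (Nat.prime_of_mem_primeFactors hq)).mpr hpq
    · have : Fact p.Prime := ⟨Nat.prime_of_mem_primeFactors hp⟩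
      exact padicValInt_dvd t
  rw [Ffun_eq_trDensity, Ffun_eq_trDensity]
  refine trDensity_eq_of_factorization (q := k) (u := u) h hkn hn _ _
    (fun _ h => map_castHom_mem_G _ h) (fun _ h => exists_map_castHom_eq_of_mem_G _ h)
    (coe_twistLevel k t) hu ?_ fun c hc => ?_
  · rw [Int.isCoprime_iff_gcd_eq_one]
    change Nat.gcd u.natAbs n = 1
    refine Nat.coprime_of_dvd fun p hp hpu hpn => ?_
    have hpk := hn (Nat.mem_primeFactors.mpr ⟨hp, hpn, n.ne_zero⟩)
    refine not_dvd_of_eq_pow_padicValInt_mul hp ht ?_ hu (Int.natCast_dvd.mpr hpu)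
    push_cast
    exact Finset.dvd_prod_of_mem (fun p : ℕ => (p : ℤ) ^ padicValInt p t) hpk
  · rw [hk.mem_G_iff_of_dvd hg hkn]
    refine ⟨GSp.scalar_mem c, ?_⟩
    have h1 : Units.map (ZMod.castHom hkn (ZMod (k : ℕ)) : ZMod (n : ℕ) →* ZMod (k : ℕ)) c = 1 :=
      Units.ext hc
    have h2 : Matrix.GeneralLinearGroup.scalar (Fin g ⊕ Fin g)
        (Units.map (ZMod.castHom hkn (ZMod (k : ℕ)) : ZMod (n : ℕ) →* ZMod (k : ℕ)) c) = 1 := by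
      rw [h1, map_one]
    rw [Matrix.GeneralLinearGroup.map_scalar]
    exact h2 ▸ one_mem (b.G k)

lemma IsLevel.G_eq_GSp {k n : ℕ+} (hk : b.IsLevel k) (hg : 1 ≤ g) (hc : Nat.Coprime n k) :
    b.G n = GSp g (ZMod (n : ℕ)) := by
  ext X
  constructor
  · intro hX
    obtain ⟨M, hM, rfl⟩ := mem_G_iff.mp hX
    exact GSp.map_mem _ ((hk M).mp hM).1
  · intro hX
    obtain ⟨M, hM, -, rfl⟩ := hk.exists_mem_range (m := 1) hg (by simpa using hc.symm)
      (one_mem _) hX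
    exact mem_G_iff.mpr ⟨M, hM, rfl⟩

lemma IsLevel.exists_mem_G_mul {k m n : ℕ+} (hk : b.IsLevel k) (hg : 1 ≤ g)
    (hm : ∀ p : ℕ, p.Prime → p ∣ m → p ∣ k) (hc : Nat.Coprime n k) :
    Nat.Coprime m n ∧ ∀ X ∈ b.G m, ∀ Y ∈ b.G n, ∃ M ∈ b.G (m * n),
      map (ZMod.castHom (PNat.mul_coe m n ▸ Nat.dvd_mul_right _ _) (ZMod (m : ℕ))) M = X ∧
      map (ZMod.castHom (PNat.mul_coe m n ▸ Nat.dvd_mul_left _ _) (ZMod (n : ℕ))) M = Y := by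
  have hmn : Nat.Coprime m n := Nat.coprime_of_dvd fun p hp h1 h2 =>
    hp.one_lt.ne' (Nat.dvd_one.mp (hc.gcd_eq_one ▸ Nat.dvd_gcd h2 (hm p hp h1)))
  refine ⟨hmn, fun X hX Y hY => ?_⟩
  rw [hk.G_eq_GSp hg hc] at hY
  obtain ⟨M, hM, rfl, rfl⟩ := hk.exists_mem_range hg
    (by rw [PNat.mul_coe]; exact hmn.mul_left hc.symm) hX hY
  exact ⟨_, mem_G_iff.mpr ⟨M, hM, rfl⟩, ZHat.map_castHom_map_proj _ M,
    ZHat.map_castHom_map_proj _ M⟩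

lemma IsLevel.Ffun_mul {k m n : ℕ+} (hk : b.IsLevel k) (hg : 1 ≤ g)
    (hm : ∀ p : ℕ, p.Prime → p ∣ m → p ∣ k) (hc : Nat.Coprime n k) (t : ℤ) :
    b.Ffun t (m * n) = b.Ffun t m * Hfun g t n := by
  obtain ⟨hmn, h⟩ := hk.exists_mem_G_mul hg hm hc
  rw [Hfun_eq_trDensity, ← hk.G_eq_GSp hg hc, Ffun_eq_trDensity, Ffun_eq_trDensity]
  exact trDensity_eq_mul hmn (PNat.mul_coe m n) _ _ _ _ _ (fun _ h => map_castHom_mem_G _ h)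
    (fun _ h => map_castHom_mem_G _ h) h t

end TateBasis

end Stability

section Shear

variable {g : ℕ} {R : Type*} [CommRing R]

namespace GSp

/-- The element of `GSp` with blocks `1, S, 0, 1`, for a symmetric matrix `S`. -/
def shear (S : Matrix (Fin g) (Fin g) R) (hS : S.IsSymm) : GSp g R :=
  ⟨⟨Matrix.fromBlocks 1 S 0 1, Matrix.fromBlocks 1 (-S) 0 1,
    by simp [Matrix.fromBlocks_multiply], by simp [Matrix.fromBlocks_multiply]⟩,
    1, by simp [sympJ, Matrix.fromBlocks_transpose, Matrix.fromBlocks_multiply, hS.eq]⟩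

lemma coe_shear_mul (S : Matrix (Fin g) (Fin g) R) (hS : S.IsSymm) (M : GSp g R) :
    (shear S hS * M).1.1 = Matrix.fromBlocks (M.1.1.toBlocks₁₁ + S * M.1.1.toBlocks₂₁)
      (M.1.1.toBlocks₁₂ + S * M.1.1.toBlocks₂₂) M.1.1.toBlocks₂₁ M.1.1.toBlocks₂₂ := by
  change Matrix.fromBlocks 1 S 0 1 * M.1.1 = _
  conv_lhs => rw [← Matrix.fromBlocks_toBlocks M.1.1]
  simp [Matrix.fromBlocks_multiply]

lemma toBlocks₂₁_shear_mul (S : Matrix (Fin g) (Fin g) R) (hS : S.IsSymm) (M : GSp g R) :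
    (shear S hS * M).1.1.toBlocks₂₁ = M.1.1.toBlocks₂₁ := by
  rw [coe_shear_mul, Matrix.toBlocks_fromBlocks₂₁]

lemma trace_shear_mul (S : Matrix (Fin g) (Fin g) R) (hS : S.IsSymm) (M : GSp g R) :
    Matrix.trace (shear S hS * M).1.1 =
      Matrix.trace M.1.1 + Matrix.trace (S * M.1.1.toBlocks₂₁) := by
  rw [coe_shear_mul]
  simp only [Matrix.trace, Matrix.diag_apply, Fintype.sum_sum_type, Matrix.fromBlocks_apply₁₁,
    Matrix.fromBlocks_apply₂₂, Matrix.add_apply, Finset.sum_add_distrib, Matrix.toBlocks₁₁,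
    Matrix.toBlocks₂₂, Matrix.of_apply]
  ring

lemma shear_mul_shear (S T : Matrix (Fin g) (Fin g) R) (hS : S.IsSymm) (hT : T.IsSymm) :
    shear S hS * shear T hT = shear (S + T) (hS.add hT) := by
  refine Subtype.ext (Units.ext ?_)
  change Matrix.fromBlocks 1 S 0 1 * Matrix.fromBlocks 1 T 0 1 = Matrix.fromBlocks 1 (S + T) 0 1
  simp [Matrix.fromBlocks_multiply, add_comm]

lemma shear_eq_one (S : Matrix (Fin g) (Fin g) R) (hS : S.IsSymm) (h : S = 0) :
    shear S hS = 1 := by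
  subst h
  exact Subtype.ext (Units.ext Matrix.fromBlocks_one)

/-- The trace is constant on the coset of `M` under shears. -/
def IsBad (M : GSp g R) : Prop :=
  ∀ S : Matrix (Fin g) (Fin g) R, S.IsSymm → Matrix.trace (S * M.1.1.toBlocks₂₁) = 0

lemma isBad_shear_mul (S : Matrix (Fin g) (Fin g) R) (hS : S.IsSymm) (M : GSp g R) :
    IsBad (shear S hS * M) ↔ IsBad M := by
  simp only [IsBad, toBlocks₂₁_shear_mul]

variable {F : Type*} [Field F]

/-- The trace is equidistributed on the elements that are not bad. -/
lemma card_mul_card_not_isBad (t : F) :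
    Nat.card F * Nat.card {M : GSp g F // ¬ IsBad M ∧ Matrix.trace M.1.1 = t} =
      Nat.card {M : GSp g F // ¬ IsBad M} := by
  have hsel : ∀ C : Matrix (Fin g) (Fin g) F, ∃ S : Matrix (Fin g) (Fin g) F, S.IsSymm ∧
      ((∃ S' : Matrix (Fin g) (Fin g) F, S'.IsSymm ∧ Matrix.trace (S' * C) ≠ 0) →
        Matrix.trace (S * C) = 1) := fun C => by
    by_cases h : ∃ S' : Matrix (Fin g) (Fin g) F, S'.IsSymm ∧ Matrix.trace (S' * C) ≠ 0
    · obtain ⟨S', hS', h'⟩ := h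
      refine ⟨(Matrix.trace (S' * C))⁻¹ • S', hS'.smul _, fun _ => ?_⟩
      rw [Matrix.smul_mul, Matrix.trace_smul, smul_eq_mul, inv_mul_cancel₀ h']
    · exact ⟨0, Matrix.isSymm_zero, fun h' => absurd h' h⟩
  choose sel hsym hsel using hsel
  let Φ : F → GSp g F → GSp g F := fun s M =>
    shear (s • sel M.1.1.toBlocks₂₁) ((hsym _).smul s) * M
  have hC : ∀ s M, (Φ s M).1.1.toBlocks₂₁ = M.1.1.toBlocks₂₁ := fun s M =>
    toBlocks₂₁_shear_mul _ _ M
  have hbad : ∀ s M, IsBad (Φ s M) ↔ IsBad M := fun s M => isBad_shear_mul _ _ M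
  have htr : ∀ s M, ¬ IsBad M → Matrix.trace (Φ s M).1.1 = Matrix.trace M.1.1 + s := by
    intro s M hM
    rw [trace_shear_mul, Matrix.smul_mul, Matrix.trace_smul, hsel, smul_eq_mul, mul_one]
    simpa [IsBad] using hM
  have hinv : ∀ s s' M, s + s' = 0 → Φ s (Φ s' M) = M := by
    intro s s' M h
    change shear (s • sel (Φ s' M).1.1.toBlocks₂₁) _ * (shear _ _ * M) = M
    rw [← mul_assoc, shear_mul_shear, shear_eq_one, one_mul]
    rw [hC, ← add_smul, h, zero_smul]
  rw [← Nat.card_prod]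
  refine Nat.card_congr ⟨fun p => ⟨Φ p.1 p.2.1, ?_⟩,
    fun M => (Matrix.trace M.1.1.1 - t, ⟨Φ (t - Matrix.trace M.1.1.1) M.1, ?_, ?_⟩), ?_, ?_⟩
  · rw [hbad]
    exact p.2.2.1
  · rw [hbad]
    exact M.2
  · rw [htr _ _ M.2]
    ring
  · rintro ⟨s, M, hM, rfl⟩
    have h1 : Matrix.trace (Φ s M).1.1 - Matrix.trace M.1.1 = s := by
      rw [htr _ _ hM]; ring
    refine Prod.ext h1 (Subtype.ext (hinv _ _ _ ?_))
    linear_combination -h1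
  · rintro ⟨M, hM⟩
    exact Subtype.ext (hinv _ _ _ (by ring))

end GSp

end Shear

section Orbit

/-- Comparing sizes through the image of a left-equivariant map. -/
lemma Group.card_mul_card_le {G X : Type*} [Group G] [Finite G] [Finite X] (φ : G → X)
    (hφ : ∀ a c d, φ a = φ c → φ (d * a) = φ (d * c)) (p : G → Prop) (P B : Set X)
    (hP : P ⊆ Set.range φ) (hB : ∀ a, p a → φ a ∈ B) :
    Nat.card {a // p a} * Nat.card P ≤ Nat.card G * Nat.card B := by
  choose! r hr using fun (y : X) (h : y ∈ Set.range φ) => h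
  have h1 : Nat.card P * Nat.card {a // φ a = φ 1} ≤ Nat.card G := by
    rw [← Nat.card_prod]
    have h : ∀ z : P × {a // φ a = φ 1}, φ (r z.1 * z.2) = z.1 := fun z => by
      rw [hφ _ _ _ z.2.2, mul_one, hr _ (hP z.1.2)]
    refine Nat.card_le_card_of_injective
      (fun z : P × {a // φ a = φ 1} => r z.1 * z.2.1) fun z w hzw => ?_
    have h2 : z.1 = w.1 := Subtype.ext (by rw [← h z, ← h w]; exact congrArg φ hzw)
    refine Prod.ext h2 (Subtype.ext ?_)
    simp only [h2] at hzw
    exact mul_left_cancel hzw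
  have h3 : Nat.card {a // p a} ≤ Nat.card B * Nat.card {a // φ a = φ 1} := by
    rw [← Nat.card_prod]
    refine Nat.card_le_card_of_injective
      (fun a : {a // p a} => ((⟨φ a.1, hB _ a.2⟩, ⟨(r (φ a.1))⁻¹ * a.1, ?_⟩) :
        B × {a // φ a = φ 1})) ?_
    · rw [← hφ _ _ _ (hr (φ a.1) ⟨a.1, rfl⟩), inv_mul_cancel]
    · rintro ⟨a, ha⟩ ⟨c, hc⟩ h
      simp only [Prod.mk.injEq, Subtype.mk.injEq] at h
      rw [h.1] at h
      exact Subtype.ext (mul_left_cancel h.2)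
  calc _ ≤ (Nat.card B * Nat.card {a // φ a = φ 1}) * Nat.card P := Nat.mul_le_mul_right _ h3
    _ = (Nat.card P * Nat.card {a // φ a = φ 1}) * Nat.card B := by ring
    _ ≤ Nat.card G * Nat.card B := Nat.mul_le_mul_right _ h1

end Orbit

section Counting

open Module in
lemma LinearIndependent.exists_linearEquiv {K V n : Type*} [Field K] [AddCommGroup V] [Module K V]
    [FiniteDimensional K V] [Finite n] {v w : n → V} (hv : LinearIndependent K v)
    (hw : LinearIndependent K w) : ∃ f : V ≃ₗ[K] V, ∀ i, f (v i) = w i := by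
  have key : ∀ {u : n → V} (hu : LinearIndependent K u) (i : n),
      Basis.sumExtend hu (Sum.inl i) = u i := fun hu i => by
    simp [Basis.sumExtend]
    rfl
  have : Finite (Basis.sumExtendIndex hv) := by
    have := Module.Finite.finite_basis (Basis.sumExtend hv)
    exact Finite.sum_right (α := n)
  have : Finite (Basis.sumExtendIndex hw) := by
    have := Module.Finite.finite_basis (Basis.sumExtend hw)
    exact Finite.sum_right (α := n)
  have hcard : Nat.card (Basis.sumExtendIndex hv) = Nat.card (Basis.sumExtendIndex hw) := by
    have h1 := Module.finrank_eq_nat_card_basis (Basis.sumExtend hv)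
    have h2 := Module.finrank_eq_nat_card_basis (Basis.sumExtend hw)
    rw [Nat.card_sum] at h1 h2
    omega
  obtain ⟨e⟩ := Finite.card_eq.mp hcard
  refine ⟨(Basis.sumExtend hv).equiv (Basis.sumExtend hw) (Equiv.sumCongr (Equiv.refl n) e),
    fun i => ?_⟩
  rw [← key hv, Basis.equiv_apply]
  exact key hw i

lemma LinearMap.card_eq_mul_card {F V W : Type*} [Field F] [AddCommGroup V] [AddCommGroup W]
    [Module F V] [Module F W] (f : V →ₗ[F] W) (hf : Function.Surjective f) :
    Nat.card V = Nat.card W * Nat.card {x // f x = 0} := by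
  have h1 := f.toAddMonoidHom.card_subtype_comp hf (fun _ => True)
  have h2 := f.toAddMonoidHom.card_subtype_comp hf (· = 0)
  simp only [Nat.card_congr (Equiv.subtypeUnivEquiv fun _ => trivial), Nat.card_unique,
    one_mul] at h1 h2
  rw [h1, ← h2]
  rfl

lemma LinearMap.card_dual_mul_card {F V : Type*} [Field F] [AddCommGroup V] [Module F V]
    (f : V →ₗ[F] F) (hf : f ≠ 0) : Nat.card F * Nat.card {x // f x = 0} = Nat.card V :=
  (f.card_eq_mul_card (LinearMap.surjective hf)).symm

/-- The solutions of a family of linear equations as a disjoint union. -/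
def Equiv.subtypeProdEquivSigma {A W C : Type*} [Zero C] (p : A → Prop) (f : A → W → C) :
    {z : A × W // p z.1 ∧ f z.1 z.2 = 0} ≃ Σ a : {a // p a}, {w // f a.1 w = 0} :=
  ⟨fun z => ⟨⟨z.1.1, z.2.1⟩, ⟨z.1.2, z.2.2⟩⟩, fun z => ⟨(z.1.1, z.2.1), z.1.2, z.2.2⟩,
    fun _ => rfl, fun _ => rfl⟩

section Family

variable {F A W : Type*} [Field F] [AddCommGroup W] [Module F W] [Finite A] [Finite W]
  (p : A → Prop) (f : A → W →ₗ[F] F)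

lemma card_mul_card_subtype_prod (hf : ∀ a, p a → f a ≠ 0) :
    Nat.card F * Nat.card {z : A × W // p z.1 ∧ f z.1 z.2 = 0} =
      Nat.card {a // p a} * Nat.card W := by
  have : Fintype {a // p a} := Fintype.ofFinite _
  rw [Nat.card_congr (Equiv.subtypeProdEquivSigma p fun a => f a), Nat.card_sigma,
    Finset.mul_sum, Finset.sum_congr rfl fun a _ => (f a.1).card_dual_mul_card (hf _ a.2)]
  simp

lemma card_mul_card_subtype_prod_le [Finite F] (a₀ : A) (hf : ∀ a, p a → a ≠ a₀ → f a ≠ 0) :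
    Nat.card F * Nat.card {z : A × W // p z.1 ∧ f z.1 z.2 = 0} ≤
      Nat.card {a // p a} * Nat.card W + Nat.card F * Nat.card W := by
  classical
  have : Fintype {a // p a} := Fintype.ofFinite _
  rw [Nat.card_congr (Equiv.subtypeProdEquivSigma p fun a => f a), Nat.card_sigma,
    Finset.mul_sum]
  calc ∑ a : {a // p a}, Nat.card F * Nat.card {w // f a.1 w = 0}
      ≤ ∑ a : {a // p a}, (Nat.card W + if a.1 = a₀ then Nat.card F * Nat.card W else 0) := by
        refine Finset.sum_le_sum fun a _ => ?_
        split_ifs with h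
        · exact le_add_left (Nat.mul_le_mul_left _ (Finite.card_subtype_le _))
        · exact ((f a.1).card_dual_mul_card (hf _ a.2 h)).le
    _ ≤ _ := by
        rw [Finset.sum_add_distrib, Finset.sum_const, smul_eq_mul, Finset.card_univ,
          ← Nat.card_eq_fintype_card]
        refine Nat.add_le_add_left ?_ _
        by_cases h : p a₀
        · rw [Finset.sum_eq_single ⟨a₀, h⟩ (fun a _ ha => if_neg fun h' => ha (Subtype.ext h'))
            (fun h' => absurd (Finset.mem_univ _) h'), if_pos rfl]
        · rw [Finset.sum_eq_zero fun a _ => if_neg fun h' : a.1 = a₀ => h (h' ▸ a.2)]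
          exact Nat.zero_le _

end Family

end Counting

section Columns

variable {g : ℕ} {F : Type*} [Field F]

/-- The symplectic pairing of two vectors of `F²ᵍ`, as a bilinear function of the pair of their
upper halves and the pair of their lower halves. -/
def halfPairing (g : ℕ) (F : Type*) [Field F] :
    ((Fin g → F) × (Fin g → F)) →ₗ[F] ((Fin g → F) × (Fin g → F)) →ₗ[F] F :=
  LinearMap.mk₂ F (fun u l => u.1 ⬝ᵥ l.2 - l.1 ⬝ᵥ u.2)
    (fun u v l => by simp only [Prod.fst_add, Prod.snd_add, add_dotProduct, dotProduct_add]; ring)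
    (fun c u l => by
      simp only [Prod.smul_fst, Prod.smul_snd, smul_dotProduct, dotProduct_smul, smul_eq_mul]; ring)
    (fun u v l => by simp only [Prod.fst_add, Prod.snd_add, add_dotProduct, dotProduct_add]; ring)
    (fun c u l => by
      simp only [Prod.smul_fst, Prod.smul_snd, smul_dotProduct, dotProduct_smul, smul_eq_mul]; ring)

lemma halfPairing_apply (u l : (Fin g → F) × (Fin g → F)) :
    halfPairing g F u l = u.1 ⬝ᵥ l.2 - l.1 ⬝ᵥ u.2 := rfl

lemma halfPairing_ne_zero {u : (Fin g → F) × (Fin g → F)} (hu : u ≠ 0) :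
    halfPairing g F u ≠ 0 := by
  refine fun h => hu (Prod.ext (funext fun i => ?_) (funext fun i => ?_))
  · have := LinearMap.congr_fun h (0, Pi.single i 1)
    simpa [halfPairing_apply] using this
  · have := LinearMap.congr_fun h (Pi.single i 1, 0)
    simpa [halfPairing_apply] using this

lemma halfPairing_flip_ne_zero {l : (Fin g → F) × (Fin g → F)} (hl : l ≠ 0) :
    (halfPairing g F).flip l ≠ 0 := by
  refine fun h => hl (Prod.ext (funext fun i => ?_) (funext fun i => ?_))
  · have := LinearMap.congr_fun h (0, Pi.single i 1)
    simpa [halfPairing_apply] using this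
  · have := LinearMap.congr_fun h (Pi.single i 1, 0)
    simpa [halfPairing_apply] using this

/-- The upper and lower halves of the first `g` columns numbered `i` and `j`. -/
def GSp.twoColumns (i j : Fin g) (M : GSp g F) :
    ((Fin g → F) × (Fin g → F)) × ((Fin g → F) × (Fin g → F)) :=
  ((fun k => M.1.1 (.inl k) (.inl i), fun k => M.1.1 (.inl k) (.inl j)),
    (fun k => M.1.1 (.inr k) (.inl i), fun k => M.1.1 (.inr k) (.inl j)))

lemma GSp.twoColumns_mul_eq (i j : Fin g) (a c d : GSp g F)
    (h : twoColumns i j a = twoColumns i j c) :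
    twoColumns i j (d * a) = twoColumns i j (d * c) := by
  simp only [twoColumns, Prod.mk.injEq, funext_iff] at h
  obtain ⟨⟨h1, h2⟩, h3, h4⟩ := h
  have key : ∀ (M : GSp g F) s t,
      (d * M).1.1 s t = ∑ k, d.1.1 s (.inl k) * M.1.1 (.inl k) t +
        ∑ k, d.1.1 s (.inr k) * M.1.1 (.inr k) t := fun M s t => by
    change (d.1.1 * M.1.1) s t = _
    rw [Matrix.mul_apply, Fintype.sum_sum_type]
  simp only [twoColumns, key, h1, h2, h3, h4]

lemma GSp.halfPairing_twoColumns (i j : Fin g) (M : GSp g F) :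
    halfPairing g F (twoColumns i j M).1 (twoColumns i j M).2 = 0 := by
  obtain ⟨u, hu⟩ := M.2
  have h := congrFun (congrFun hu (.inl i)) (.inl j)
  rw [transpose_mul_sympJ_mul_apply] at h
  simp only [halfPairing_apply, twoColumns, dotProduct, ← Finset.sum_sub_distrib]
  rw [h]
  simp [sympJ]

lemma GSp.exists_twoColumns_eq {i j : Fin g} (hij : i ≠ j)
    {u l : (Fin g → F) × (Fin g → F)} (hu : LinearIndependent F ![u.1, u.2])
    (hul : halfPairing g F u l = 0) : ∃ M : GSp g F, twoColumns i j M = (u, l) := by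
  classical
  have hw : LinearIndependent F (![Pi.single i 1, Pi.single j 1] : Fin 2 → Fin g → F) := by
    have h := (Pi.basisFun F (Fin g)).linearIndependent.comp ![i, j] (by
      intro x y hxy
      fin_cases x <;> fin_cases y <;> simp_all [eq_comm])
    convert h using 1
    ext x
    fin_cases x <;> simp
  obtain ⟨f, hf⟩ := hw.exists_linearEquiv hu
  have hf0 : f (Pi.single i 1) = u.1 := hf 0
  have hf1 : f (Pi.single j 1) = u.2 := hf 1
  set A : Matrix (Fin g) (Fin g) F := LinearMap.toMatrix' (f : (Fin g → F) →ₗ[F] Fin g → F)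
    with hA
  set A' : Matrix (Fin g) (Fin g) F :=
    (LinearMap.toMatrix' (f.symm : (Fin g → F) →ₗ[F] Fin g → F)).transpose with hA'
  have hA'A : A'.transpose * A = 1 := by
    rw [hA', hA, Matrix.transpose_transpose, ← LinearMap.toMatrix'_comp]
    simp
  have hAA' : A.transpose * A' = 1 := by
    rw [← Matrix.transpose_one, ← hA'A, Matrix.transpose_mul, Matrix.transpose_transpose]
  have hA'A2 : A' * A.transpose = 1 := mul_eq_one_comm.mp hAA'
  have hAi : ∀ k, A k i = u.1 k := fun k => by
    rw [hA, LinearMap.toMatrix'_apply, ← hf0]; rfl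
  have hAj : ∀ k, A k j = u.2 k := fun k => by
    rw [hA, LinearMap.toMatrix'_apply, ← hf1]; rfl
  set α := A.transpose.mulVec l.1 with hα
  set β := A.transpose.mulVec l.2 with hβ
  have hαβ : α j = β i := by
    have h1 : α j = u.2 ⬝ᵥ l.1 := by
      simp only [hα, Matrix.mulVec, dotProduct, Matrix.transpose_apply, hAj]
    have h2 : β i = u.1 ⬝ᵥ l.2 := by
      simp only [hβ, Matrix.mulVec, dotProduct, Matrix.transpose_apply, hAi]
    rw [halfPairing_apply] at hul
    rw [h1, h2, dotProduct_comm u.2]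
    linear_combination -hul
  let T : Matrix (Fin g) (Fin g) F := Matrix.of fun r s =>
    if s = i then α r else if s = j then β r else if r = i then α s else if r = j then β s else 0
  have hT : T.transpose = T := by
    ext r s
    simp only [T, Matrix.transpose_apply, Matrix.of_apply]
    by_cases hri : r = i <;> by_cases hrj : r = j <;> by_cases hsi : s = i <;>
      by_cases hsj : s = j <;> simp_all
  obtain ⟨M, hM, hMe⟩ := GSp.exists_coe_eq (Matrix.fromBlocks A 0 (A' * T) A') 1 (by
    have h1 : T.transpose * A'.transpose * A = T := by
      rw [hT, Matrix.mul_assoc, hA'A, Matrix.mul_one]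
    have h2 : A.transpose * (A' * T) = T := by
      rw [← Matrix.mul_assoc, hAA', Matrix.one_mul]
    simp [sympJ, Matrix.fromBlocks_transpose, Matrix.fromBlocks_multiply, h1, h2, hAA', hA'A])
  have hcol : ∀ (s : Fin g) (v : Fin g → F), (∀ r, T r s = A.transpose.mulVec v r) →
      ∀ k, (A' * T) k s = v k := fun s v h k => by
    have : (A' * T) k s = A'.mulVec (A.transpose.mulVec v) k := by
      simp only [Matrix.mul_apply, h]
      rfl
    rw [this, Matrix.mulVec_mulVec, hA'A2, Matrix.one_mulVec]
  refine ⟨⟨M, hM⟩, ?_⟩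
  simp only [twoColumns, hMe, Matrix.fromBlocks_apply₁₁, Matrix.fromBlocks_apply₂₁, hAi, hAj]
  refine Prod.ext rfl (Prod.ext (funext fun k => ?_) (funext fun k => ?_))
  · exact hcol i l.1 (fun r => by simp [T, hα]) k
  · exact hcol j l.2 (fun r => by simp [T, hij.symm, hβ]) k

end Columns

section BadCount

variable {g : ℕ} {F : Type*} [Field F]

lemma GSp.IsBad.apply_self {M : GSp g F} (hM : IsBad M) (i : Fin g) :
    M.1.1 (.inr i) (.inl i) = 0 := by
  have h := hM (Matrix.single i i 1) (by ext; simp [Matrix.single_apply, and_comm])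
  simpa [Matrix.trace_single_mul, Matrix.toBlocks₂₁] using h

lemma GSp.IsBad.apply_add_apply {M : GSp g F} (hM : IsBad M) {i j : Fin g} :
    M.1.1 (.inr j) (.inl i) + M.1.1 (.inr i) (.inl j) = 0 := by
  have h := hM (Matrix.single i j 1 + Matrix.single j i 1) (by
    ext; simp [Matrix.single_apply, and_comm, add_comm])
  rw [Matrix.add_mul, Matrix.trace_add] at h
  simpa [Matrix.trace_single_mul, Matrix.toBlocks₂₁] using h

variable [Finite F]

/-- For `g ≥ 2`, the proportion of bad elements is `O(q⁻³)`. -/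
lemma GSp.card_isBad_le (hg : 2 ≤ g) :
    Nat.card F ^ 3 * Nat.card {M : GSp g F // IsBad M} ≤ 8 * Nat.card (GSp g F) := by
  set q := Nat.card F with hq
  have hq2 : 2 ≤ q := Finite.one_lt_card
  let i : Fin g := ⟨0, by omega⟩
  let j : Fin g := ⟨1, by omega⟩
  have hij : i ≠ j := by simp [i, j]
  let V := (Fin g → F) × (Fin g → F)
  let P : Set (V × V) := {z | LinearIndependent F ![z.1.1, z.1.2] ∧ halfPairing g F z.1 z.2 = 0}
  let B : Set (V × V) := {z | (z.2.1 i = 0 ∧ z.2.2 j = 0 ∧ z.2.1 j + z.2.2 i = 0) ∧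
    halfPairing g F z.1 z.2 = 0}
  have hmain := Group.card_mul_card_le (twoColumns (F := F) i j) (twoColumns_mul_eq i j) IsBad P B
    (fun z hz => by
      obtain ⟨M, hM⟩ := exists_twoColumns_eq hij hz.1 hz.2
      exact ⟨M, hM⟩)
    (fun M hM => ⟨⟨hM.apply_self i, hM.apply_self j, hM.apply_add_apply⟩,
      halfPairing_twoColumns i j M⟩)
  have hV : Nat.card V = q ^ (2 * g) := by
    rw [Nat.card_prod, Nat.card_fun, Nat.card_eq_fintype_card (α := Fin g), Fintype.card_fin,
      ← pow_add, two_mul]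
  have hP : q * Nat.card P =
      Nat.card {u : V // LinearIndependent F ![u.1, u.2]} * q ^ (2 * g) := by
    rw [← hV]
    exact card_mul_card_subtype_prod (fun u : V => LinearIndependent F ![u.1, u.2])
      (fun u => halfPairing g F u) fun u hu => halfPairing_ne_zero fun h =>
        hu.ne_zero 0 (congrArg Prod.fst h)
  have hLI : Nat.card {u : V // LinearIndependent F ![u.1, u.2]} =
      (q ^ g - 1) * (q ^ g - q) := by
    have : Fintype F := Fintype.ofFinite F
    have h := card_linearIndependent (K := F) (V := Fin g → F) (k := 2) (by simpa using hg)
    rw [Fin.prod_univ_two] at h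
    simp only [Module.finrank_fin_fun, Fin.val_zero, Fin.val_one, pow_zero, pow_one,
      ← Nat.card_eq_fintype_card] at h
    rw [hq, ← h]
    refine Nat.card_congr (Equiv.subtypeEquiv (finTwoArrowEquiv _).symm fun u => ?_)
    exact Iff.rfl
  have hD : q ^ 3 * Nat.card {l : V // l.1 i = 0 ∧ l.2 j = 0 ∧ l.1 j + l.2 i = 0} =
      q ^ (2 * g) := by
    let f : V →ₗ[F] F × F × F :=
      { toFun := fun l => (l.1 i, l.2 j, l.1 j + l.2 i)
        map_add' := fun _ _ => Prod.ext rfl (Prod.ext rfl (add_add_add_comm _ _ _ _))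
        map_smul' := fun _ _ => Prod.ext rfl (Prod.ext rfl (mul_add _ _ _).symm) }
    have hf : Function.Surjective f := fun ⟨x, y, z⟩ =>
      ⟨(Pi.single i x + Pi.single j z, Pi.single j y), by simp [f, hij, hij.symm]⟩
    have h := f.card_eq_mul_card hf
    rw [hV, Nat.card_prod, Nat.card_prod] at h
    rw [h, pow_succ, pow_two, ← mul_assoc]
    congr 1
    refine Nat.card_congr (Equiv.subtypeEquivRight fun l => ?_)
    simp [f]
  have hB : q * Nat.card B ≤
      Nat.card {l : V // l.1 i = 0 ∧ l.2 j = 0 ∧ l.1 j + l.2 i = 0} * q ^ (2 * g) +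
        q * q ^ (2 * g) := by
    have h := card_mul_card_subtype_prod_le
      (fun l : V => l.1 i = 0 ∧ l.2 j = 0 ∧ l.1 j + l.2 i = 0)
      (fun l => (halfPairing g F).flip l) 0 fun l _ hl => halfPairing_flip_ne_zero hl
    rw [hV] at h
    refine le_trans (Nat.mul_le_mul_left _ (Nat.card_congr ?_).le) h
    exact Equiv.subtypeEquiv (Equiv.prodComm _ _) fun z => Iff.rfl
  have hLI4 : q ^ (2 * g) ≤ 4 * ((q ^ g - 1) * (q ^ g - q)) := by
    have h1 : q * q ≤ q ^ g := by
      rw [← pow_two]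
      exact Nat.pow_le_pow_right (by omega) hg
    have h2 : 2 * q ≤ q * q := Nat.mul_le_mul_right _ hq2
    have h3 : q ^ g ≤ 2 * (q ^ g - 1) := by omega
    have h4 : q ^ g ≤ 2 * (q ^ g - q) := by omega
    calc q ^ (2 * g) = q ^ g * q ^ g := by rw [two_mul, pow_add]
      _ ≤ 2 * (q ^ g - 1) * (2 * (q ^ g - q)) := Nat.mul_le_mul h3 h4
      _ = _ := by ring
  have hB2 : q ^ 4 * Nat.card B ≤ 2 * (q ^ (2 * g) * q ^ (2 * g)) := by
    have h1 : q ^ 4 ≤ q ^ (2 * g) := Nat.pow_le_pow_right (by omega) (by omega)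
    calc q ^ 4 * Nat.card B = q ^ 3 * (q * Nat.card B) := by ring
      _ ≤ _ := Nat.mul_le_mul_left _ hB
      _ = (q ^ 3 * Nat.card {l : V // l.1 i = 0 ∧ l.2 j = 0 ∧ l.1 j + l.2 i = 0}) * q ^ (2 * g) +
          q ^ 4 * q ^ (2 * g) := by ring
      _ ≤ q ^ (2 * g) * q ^ (2 * g) + q ^ (2 * g) * q ^ (2 * g) := by
          rw [hD]
          exact Nat.add_le_add_left (Nat.mul_le_mul_right _ h1) _
      _ = _ := by ring
  have hP2 : q ^ (2 * g) * q ^ (2 * g) ≤ 4 * (q * Nat.card P) := by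
    rw [hP, hLI, ← mul_assoc]
    exact Nat.mul_le_mul_right _ hLI4
  have hpos : 0 < q ^ (2 * g) * q ^ (2 * g) := by positivity
  refine Nat.le_of_mul_le_mul_right (c := q ^ (2 * g) * q ^ (2 * g)) ?_ hpos
  calc _ ≤ q ^ 3 * Nat.card {M : GSp g F // IsBad M} * (4 * (q * Nat.card P)) :=
        Nat.mul_le_mul_left _ hP2
    _ = 4 * q ^ 4 * (Nat.card {M : GSp g F // IsBad M} * Nat.card P) := by ring
    _ ≤ 4 * q ^ 4 * (Nat.card (GSp g F) * Nat.card B) := Nat.mul_le_mul_left _ hmain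
    _ = 4 * Nat.card (GSp g F) * (q ^ 4 * Nat.card B) := by ring
    _ ≤ 4 * Nat.card (GSp g F) * (2 * (q ^ (2 * g) * q ^ (2 * g))) := Nat.mul_le_mul_left _ hB2
    _ = _ := by ring

end BadCount

section RankOne

variable {F : Type*} [Field F]

namespace GSp

lemma det_ne_zero_of_rank_one (M : GSp 1 F) :
    M.1.1 (.inl 0) (.inl 0) * M.1.1 (.inr 0) (.inr 0) -
      M.1.1 (.inr 0) (.inl 0) * M.1.1 (.inl 0) (.inr 0) ≠ 0 := by
  obtain ⟨u, hu⟩ := M.2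
  have h := congrFun (congrFun hu (.inl 0)) (.inr 0)
  rw [transpose_mul_sympJ_mul_apply, Fin.sum_univ_one] at h
  rw [h]
  simp [sympJ]

lemma exists_rank_one {a b c d : F} (h : a * d - c * b ≠ 0) : ∃ M : GSp 1 F,
    M.1.1 (.inl 0) (.inl 0) = a ∧ M.1.1 (.inl 0) (.inr 0) = b ∧
      M.1.1 (.inr 0) (.inl 0) = c ∧ M.1.1 (.inr 0) (.inr 0) = d := by
  obtain ⟨M, hM, hMe⟩ := exists_coe_eq (g := 1) (Matrix.fromBlocks (Matrix.of fun _ _ => a)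
    (Matrix.of fun _ _ => b) (Matrix.of fun _ _ => c) (Matrix.of fun _ _ => d))
    (Units.mk0 _ h) (by
      ext i j
      rw [transpose_mul_sympJ_mul_apply, Fin.sum_univ_one]
      rcases i with i | i <;> rcases j with j | j <;>
        simp [sympJ, Subsingleton.elim i 0, Subsingleton.elim j 0] <;> ring)
  exact ⟨⟨M, hM⟩, by simp [hMe]⟩

lemma ext_of_rank_one {M N : GSp 1 F} (h1 : M.1.1 (.inl 0) (.inl 0) = N.1.1 (.inl 0) (.inl 0))
    (h2 : M.1.1 (.inl 0) (.inr 0) = N.1.1 (.inl 0) (.inr 0))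
    (h3 : M.1.1 (.inr 0) (.inl 0) = N.1.1 (.inr 0) (.inl 0))
    (h4 : M.1.1 (.inr 0) (.inr 0) = N.1.1 (.inr 0) (.inr 0)) : M = N := by
  refine Subtype.ext (Units.ext (Matrix.ext fun i j => ?_))
  rcases i with i | i <;> rcases j with j | j <;>
    rw [Subsingleton.elim i 0, Subsingleton.elim j 0] <;> assumption

lemma trace_rank_one (M : GSp 1 F) :
    Matrix.trace M.1.1 = M.1.1 (.inl 0) (.inl 0) + M.1.1 (.inr 0) (.inr 0) := by
  simp [Matrix.trace, Fintype.sum_sum_type]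

lemma isBad_iff_rank_one (M : GSp 1 F) : IsBad M ↔ M.1.1 (.inr 0) (.inl 0) = 0 := by
  refine ⟨fun h => h.apply_self 0, fun h S _ => ?_⟩
  simp [Matrix.trace, Matrix.mul_apply, Matrix.toBlocks₂₁, h]

lemma card_isBad_rank_one :
    Nat.card {M : GSp 1 F // IsBad M} = Nat.card F * (Nat.card Fˣ * Nat.card Fˣ) := by
  rw [← Nat.card_prod, ← Nat.card_prod]
  symm
  choose f hf using fun x : F × Fˣ × Fˣ =>
    exists_rank_one (a := (x.2.1 : F)) (b := x.1) (c := 0) (d := (x.2.2 : F)) (by simp)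
  refine Nat.card_congr (Equiv.ofBijective
    (fun x => ⟨f x, (isBad_iff_rank_one _).mpr (hf x).2.2.1⟩) ⟨fun x y hxy => ?_, fun M => ?_⟩)
  · have h : f x = f y := congrArg Subtype.val hxy
    refine Prod.ext ?_ (Prod.ext (Units.ext ?_) (Units.ext ?_))
    · rw [← (hf x).2.1, h, (hf y).2.1]
    · rw [← (hf x).1, h, (hf y).1]
    · rw [← (hf x).2.2.2, h, (hf y).2.2.2]
  · have h0 := (isBad_iff_rank_one _).mp M.2
    have h := det_ne_zero_of_rank_one M.1
    rw [h0, zero_mul, sub_zero] at h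
    obtain ⟨h1, h2, h3, h4⟩ := hf (M.1.1.1 (.inl 0) (.inr 0),
      Units.mk0 _ (left_ne_zero_of_mul h), Units.mk0 _ (right_ne_zero_of_mul h))
    exact ⟨_, Subtype.ext (ext_of_rank_one h1 h2 (h3.trans h0.symm) h4)⟩

lemma card_isBad_trace_rank_one (t : F) :
    Nat.card {M : GSp 1 F // IsBad M ∧ Matrix.trace M.1.1 = t} =
      Nat.card F * Nat.card {a : Fˣ // t - a ≠ 0} := by
  rw [← Nat.card_prod]
  symm
  choose f hf using fun x : F × {a : Fˣ // t - a ≠ 0} =>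
    exists_rank_one (a := (x.2.1 : F)) (b := x.1) (c := 0) (d := t - x.2.1)
      (by simpa using x.2.2)
  refine Nat.card_congr (Equiv.ofBijective
    (fun x => ⟨f x, (isBad_iff_rank_one _).mpr (hf x).2.2.1, ?_⟩) ⟨fun x y hxy => ?_, fun M => ?_⟩)
  · rw [trace_rank_one, (hf x).1, (hf x).2.2.2]
    ring
  · have h : f x = f y := congrArg Subtype.val hxy
    refine Prod.ext ?_ (Subtype.ext (Units.ext ?_))
    · rw [← (hf x).2.1, h, (hf y).2.1]
    · rw [← (hf x).1, h, (hf y).1]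
  · have h0 := (isBad_iff_rank_one _).mp M.2.1
    have ht := M.2.2
    rw [trace_rank_one] at ht
    have h := det_ne_zero_of_rank_one M.1
    rw [h0, zero_mul, sub_zero] at h
    obtain ⟨h1, h2, h3, h4⟩ := hf (M.1.1.1 (.inl 0) (.inr 0),
      ⟨Units.mk0 _ (left_ne_zero_of_mul h), by
        rw [Units.val_mk0, sub_eq_of_eq_add' ht.symm]; exact right_ne_zero_of_mul h⟩)
    refine ⟨_, Subtype.ext (ext_of_rank_one h1 h2 (h3.trans h0.symm) (h4.trans ?_))⟩
    exact sub_eq_of_eq_add' ht.symm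

variable [Finite F]

lemma card_le_card_rank_one :
    (Nat.card F * Nat.card Fˣ) ^ 2 ≤ Nat.card (GSp 1 F) := by
  have : (Nat.card F * Nat.card Fˣ) ^ 2 = Nat.card ((F × F) × (Fˣ × Fˣ)) := by
    simp only [Nat.card_prod]; ring
  rw [this]
  choose f hf using fun x : (F × F) × (Fˣ × Fˣ) =>
    exists_rank_one (a := x.1.1) (b := (x.2.1 : F)⁻¹ * (x.1.1 * x.1.2 - x.2.2)) (c := (x.2.1 : F))
      (d := x.1.2) (by rw [mul_inv_cancel_left₀ x.2.1.ne_zero]; simp)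
  refine Nat.card_le_card_of_injective f fun x y h => ?_
  have h1 : x.1.1 = y.1.1 := by rw [← (hf x).1, h, (hf y).1]
  have h2 : x.1.2 = y.1.2 := by rw [← (hf x).2.2.2, h, (hf y).2.2.2]
  have h3 : x.2.1 = y.2.1 := Units.ext (by rw [← (hf x).2.2.1, h, (hf y).2.2.1])
  have h4 := (hf x).2.1
  rw [h, (hf y).2.1, h1, h2, h3] at h4
  have h5 := mul_left_cancel₀ (inv_ne_zero y.2.1.ne_zero) h4
  exact Prod.ext (Prod.ext h1 h2) (Prod.ext h3 (Units.ext (sub_right_inj.mp h5).symm))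

end GSp

lemma card_units_sub_ne_zero [Finite F] (t : F) :
    Nat.card {a : Fˣ // t - a ≠ 0} ≤ Nat.card Fˣ ∧
      Nat.card Fˣ ≤ Nat.card {a : Fˣ // t - a ≠ 0} + 1 := by
  classical
  refine ⟨Finite.card_subtype_le _, ?_⟩
  rw [← Nat.card_congr (Equiv.sumCompl fun a : Fˣ => t - a ≠ 0), Nat.card_sum]
  refine Nat.add_le_add_left ?_ _
  rw [Finite.card_le_one_iff_subsingleton]
  refine ⟨fun a c => Subtype.ext (Units.ext ?_)⟩
  have h1 := not_not.mp a.2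
  have h2 := not_not.mp c.2
  linear_combination h2 - h1

end RankOne

section Deviation

lemma Nat.card_subtype_eq_add {X : Type*} [Finite X] (p b : X → Prop) :
    Nat.card {x // p x} = Nat.card {x // ¬ b x ∧ p x} + Nat.card {x // b x ∧ p x} := by
  classical
  rw [← Nat.card_congr (Equiv.sumCompl fun x : {x // p x} => b x), Nat.card_sum, add_comm]
  congr 1
  · exact Nat.card_congr ((Equiv.subtypeSubtypeEquivSubtypeInter p (fun x => ¬ b x)).trans
      (Equiv.subtypeEquivRight fun _ => and_comm))
  · exact Nat.card_congr ((Equiv.subtypeSubtypeEquivSubtypeInter p b).trans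
      (Equiv.subtypeEquivRight fun _ => and_comm))

namespace GSp

variable {F : Type*} [Field F] [Finite F] {g : ℕ}

lemma card_mul_card_trace_sub (t : F) :
    (Nat.card F : ℝ) * Nat.card {M : GSp g F // Matrix.trace M.1.1 = t} - Nat.card (GSp g F) =
      (Nat.card F : ℝ) * Nat.card {M : GSp g F // IsBad M ∧ Matrix.trace M.1.1 = t} -
        Nat.card {M : GSp g F // IsBad M} := by
  have h1 := Nat.card_subtype_eq_add (fun M : GSp g F => Matrix.trace M.1.1 = t) IsBad
  have h2 := Nat.card_subtype_eq_add (fun _ : GSp g F => True) IsBad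
  simp only [Nat.card_congr (Equiv.subtypeUnivEquiv fun _ => trivial), and_true] at h2
  have h3 := card_mul_card_not_isBad (g := g) t
  rw [h1, h2, ← h3]
  push_cast
  ring

/-- The trace is equidistributed on `GSp(F)` up to a relative error `O(q⁻²)`. -/
lemma abs_card_mul_card_trace_sub_le (hg : 1 ≤ g) (t : F) :
    (Nat.card F : ℝ) ^ 2 * |(Nat.card F : ℝ) * Nat.card {M : GSp g F // Matrix.trace M.1.1 = t} -
      Nat.card (GSp g F)| ≤ 8 * Nat.card (GSp g F) := by
  rw [card_mul_card_trace_sub]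
  have hq2 : (2 : ℝ) ≤ Nat.card F := by exact_mod_cast (Finite.one_lt_card : 1 < Nat.card F)
  rcases hg.eq_or_lt with rfl | hg
  · have hu : (Nat.card Fˣ : ℝ) = Nat.card F - 1 := by
      rw [Nat.card_units, Nat.cast_sub Finite.one_lt_card.le, Nat.cast_one]
    obtain ⟨h1, h2⟩ := card_units_sub_ne_zero t
    have h3 : ((Nat.card F : ℝ) * Nat.card Fˣ) ^ 2 ≤ Nat.card (GSp 1 F) := by
      exact_mod_cast card_le_card_rank_one (F := F)
    rw [card_isBad_trace_rank_one, card_isBad_rank_one]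
    push_cast
    have h1' : (Nat.card {a : Fˣ // t - a ≠ 0} : ℝ) ≤ Nat.card F - 1 := by
      rw [← hu]; exact_mod_cast h1
    have h2' : (Nat.card F : ℝ) - 1 ≤ Nat.card {a : Fˣ // t - a ≠ 0} + 1 := by
      rw [← hu]; exact_mod_cast h2
    rw [hu] at h3 ⊢
    generalize (Nat.card {a : Fˣ // t - a ≠ 0} : ℝ) = m at *
    generalize (Nat.card F : ℝ) = q at *
    have h4 : |q * (q * m) - q * ((q - 1) * (q - 1))| ≤ q * q := by
      rw [← mul_sub, abs_mul, abs_of_nonneg (by linarith : 0 ≤ q)]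
      refine mul_le_mul_of_nonneg_left (abs_le.mpr ⟨?_, ?_⟩) (by linarith)
      · nlinarith
      · nlinarith
    have h5 : q * q ≤ 2 * (q * (q - 1)) := by nlinarith
    calc q ^ 2 * |q * (q * m) - q * ((q - 1) * (q - 1))| ≤ q ^ 2 * (q * q) :=
          mul_le_mul_of_nonneg_left h4 (sq_nonneg q)
      _ = (q * q) ^ 2 := by ring
      _ ≤ (2 * (q * (q - 1))) ^ 2 := pow_le_pow_left₀ (by positivity) h5 2
      _ ≤ _ := by nlinarith [sq_nonneg (q * (q - 1))]
  · have h1 : (Nat.card F : ℝ) ^ 3 * Nat.card {M : GSp g F // IsBad M} ≤ 8 * Nat.card (GSp g F) := by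
      exact_mod_cast card_isBad_le (F := F) hg
    have h2 : (Nat.card {M : GSp g F // IsBad M ∧ Matrix.trace M.1.1 = t} : ℝ) ≤
        Nat.card {M : GSp g F // IsBad M} := by
      exact_mod_cast Nat.card_le_card_of_injective
        (fun M : {M : GSp g F // IsBad M ∧ Matrix.trace M.1.1 = t} =>
          (⟨M.1, M.2.1⟩ : {M : GSp g F // IsBad M}))
        (fun M N h => Subtype.ext (congrArg Subtype.val h :))
    have h3 : (0 : ℝ) ≤ Nat.card {M : GSp g F // IsBad M ∧ Matrix.trace M.1.1 = t} := Nat.cast_nonneg _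
    generalize (Nat.card {M : GSp g F // IsBad M ∧ Matrix.trace M.1.1 = t} : ℝ) = m at *
    generalize (Nat.card {M : GSp g F // IsBad M} : ℝ) = k at *
    generalize (Nat.card F : ℝ) = q at *
    have h4 : |q * m - k| ≤ q * k := abs_le.mpr ⟨by nlinarith, by nlinarith⟩
    calc q ^ 2 * |q * m - k| ≤ q ^ 2 * (q * k) := mul_le_mul_of_nonneg_left h4 (sq_nonneg q)
      _ = q ^ 3 * k := by ring
      _ ≤ _ := h1

/-- Every trace occurs in `GSp`. -/
lemma exists_trace_eq {R : Type*} [CommRing R] (hg : 1 ≤ g) (t : R) :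
    ∃ M : GSp g R, Matrix.trace M.1.1 = t := by
  obtain ⟨M, hM, hMe⟩ := exists_coe_eq
    (Matrix.fromBlocks (Matrix.single ⟨0, hg⟩ ⟨0, hg⟩ t) (-1) 1 0 : Matrix (Fin g ⊕ Fin g) _ R) 1
    (by simp [sympJ, Matrix.fromBlocks_transpose, Matrix.fromBlocks_multiply])
  refine ⟨⟨M, hM⟩, ?_⟩
  rw [hMe, Matrix.trace, Fintype.sum_sum_type]
  simp [Matrix.single_apply]

end GSp

lemma Hfun_pos {g : ℕ} (hg : 1 ≤ g) (t : ℤ) {m : ℕ} (hm : m ≠ 0) : 0 < Hfun g t m := by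
  have : NeZero m := ⟨hm⟩
  obtain ⟨M, hM⟩ := GSp.exists_trace_eq hg (t : ZMod m)
  have : Nonempty {M : GSp g (ZMod m) // Matrix.trace M.1.1 = (t : ZMod m)} := ⟨⟨M, hM⟩⟩
  have h1 : (0 : ℝ) < Nat.card {M : GSp g (ZMod m) // Matrix.trace M.1.1 = (t : ZMod m)} :=
    Nat.cast_pos.mpr Nat.card_pos
  have h2 : (0 : ℝ) < Nat.card (GSp g (ZMod m)) := Nat.cast_pos.mpr Nat.card_pos
  have h3 : (0 : ℝ) < m := Nat.cast_pos.mpr (Nat.pos_of_ne_zero hm)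
  rw [Hfun]
  positivity

lemma abs_Hfun_sub_one_le {g : ℕ} (hg : 1 ≤ g) (t : ℤ) {p : ℕ} (hp : p.Prime) :
    |Hfun g t p - 1| ≤ 8 * ((p : ℝ) ^ 2)⁻¹ := by
  have : Fact p.Prime := ⟨hp⟩
  have h := GSp.abs_card_mul_card_trace_sub_le hg (t : ZMod p)
  rw [Nat.card_zmod] at h
  have h2 : (0 : ℝ) < Nat.card (GSp g (ZMod p)) := Nat.cast_pos.mpr Nat.card_pos
  have h3 : (0 : ℝ) < p := Nat.cast_pos.mpr hp.pos
  rw [Hfun, div_sub_one h2.ne', abs_div, abs_of_pos h2, div_le_iff₀ h2, ← div_eq_mul_inv,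
    div_mul_eq_mul_div, le_div_iff₀ (by positivity), mul_comm]
  exact h

lemma Real.multipliable_and_tprod_pos {X : Type*} {f : X → ℝ} (hf : ∀ x, 0 < f x)
    (hs : Summable fun x => f x - 1) : Multipliable f ∧ 0 < ∏' x, f x := by
  have h : Summable fun x => Real.log (f x) := by
    simpa using Real.summable_log_one_add_of_summable hs
  exact ⟨Real.multipliable_of_summable_log hf h,
    Real.rexp_tsum_eq_tprod hf h ▸ Real.exp_pos _⟩

lemma summable_Hfun_sub_one {g : ℕ} (hg : 1 ≤ g) (t : ℤ) :
    Summable fun p : Nat.Primes => Hfun g t p - 1 := by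
  have h : Summable fun p : Nat.Primes => 8 * (((p : ℕ) : ℝ) ^ 2)⁻¹ :=
    ((Real.summable_nat_pow_inv.mpr one_lt_two).comp_injective
      Nat.Primes.coe_nat_injective).mul_left 8
  exact Summable.of_norm_bounded h fun p => abs_Hfun_sub_one_le hg t p.2

lemma summable_Hfun_pow_sub_one {g : ℕ} (hg : 1 ≤ g) {t : ℤ} (ht : t ≠ 0) :
    Summable fun p : Nat.Primes => Hfun g t ((p : ℕ) ^ (padicValInt p t + 1)) - 1 := by
  refine (summable_Hfun_sub_one hg t).congr_cofinite ?_
  have hfin : {p : Nat.Primes | (p : ℕ) ≤ t.natAbs}.Finite :=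
    Set.Finite.of_finite_image ((Set.finite_Iic t.natAbs).subset (by
      rintro _ ⟨p, hp, rfl⟩
      exact hp)) Nat.Primes.coe_nat_injective.injOn
  filter_upwards [hfin.compl_mem_cofinite] with p hp
  have h : padicValInt p t = 0 := padicValInt.eq_zero_of_not_dvd fun h =>
    hp (Nat.le_of_dvd (Int.natAbs_pos.mpr ht) (Int.natCast_dvd.mp h))
  rw [h, zero_add, pow_one]

end Deviation

section Limit

/-- The partial products over the primes up to `n` not dividing `k` converge to the product. -/
lemma tendsto_prod_primes_not_dvd {k : ℕ} {f : ℕ → ℝ}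
    (hf : Multipliable fun p : {p : Nat.Primes // ¬ (p : ℕ) ∣ k} => f p) :
    Filter.Tendsto
      (fun n => ∏ p ∈ ((Finset.range (n + 1)).filter Nat.Prime).filter (¬ · ∣ k), f p)
      Filter.atTop (nhds (∏' p : {p : Nat.Primes // ¬ (p : ℕ) ∣ k}, f p)) := by
  classical
  let F : ℕ → ℝ := fun p => if p.Prime ∧ ¬ p ∣ k then f p else 1
  have hinj : Function.Injective (fun p : {p : Nat.Primes // ¬ (p : ℕ) ∣ k} => (p : ℕ)) :=
    Nat.Primes.coe_nat_injective.comp Subtype.val_injective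
  have hF : F ∘ (fun p : {p : Nat.Primes // ¬ (p : ℕ) ∣ k} => (p : ℕ)) =
      fun p : {p : Nat.Primes // ¬ (p : ℕ) ∣ k} => f p :=
    funext fun p => if_pos ⟨p.1.2, p.2⟩
  have h : HasProd F (∏' p : {p : Nat.Primes // ¬ (p : ℕ) ∣ k}, f p) := by
    rw [← hinj.hasProd_iff fun x hx => if_neg fun h => hx ⟨⟨⟨x, h.1⟩, h.2⟩, rfl⟩, hF]
    exact hf.hasProd
  refine (h.tendsto_prod_nat.comp (Filter.tendsto_add_atTop_nat 1)).congr fun n => ?_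
  rw [Finset.filter_filter, Finset.prod_filter]
  rfl

namespace TateBasis

variable {A : Over (Spec (.of ℚ))} [GrpObj A] [IsCommMonObj A] {g : ℕ} {b : TateBasis A g}

lemma IsLevel.Ffun_mSeq_eq {k : ℕ+} (hk : b.IsLevel k) (hg : 1 ≤ g) {t : ℤ} (ht : t ≠ 0) {n : ℕ}
    (hn : (twistLevel k t : ℕ) ≤ n) (hnt : t.natAbs + 1 ≤ n) :
    b.Ffun t (mSeq n) = b.Ffun t (twistLevel k t) *
      ∏ p ∈ ((Finset.range (n + 1)).filter Nat.Prime).filter (¬ · ∣ (k : ℕ)),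
        Hfun g t (p ^ (padicValInt p t + 1)) := by
  set s := (Finset.range (n + 1)).filter Nat.Prime with hs
  have hsp : ∀ p ∈ s, p.Prime := fun p hp => (Finset.mem_filter.mp hp).2
  have hpos : ∀ r ⊆ s, 0 < ∏ p ∈ r, p ^ n := fun r hr =>
    Finset.prod_pos fun p hp => pow_pos (hsp p (hr hp)).pos n
  let m₁ : ℕ+ := ⟨∏ p ∈ s.filter (· ∣ (k : ℕ)), p ^ n, hpos _ (Finset.filter_subset _ _)⟩
  let m₂ : ℕ+ := ⟨∏ p ∈ s.filter (¬ · ∣ (k : ℕ)), p ^ n, hpos _ (Finset.filter_subset _ _)⟩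
  have hc₁ : (m₁ : ℕ) = ∏ p ∈ s.filter (· ∣ (k : ℕ)), p ^ n := rfl
  have hc₂ : (m₂ : ℕ) = ∏ p ∈ s.filter (¬ · ∣ (k : ℕ)), p ^ n := rfl
  have hm : mSeq n = m₁ * m₂ :=
    PNat.coe_injective (Finset.prod_filter_mul_prod_filter_not s (· ∣ (k : ℕ)) _).symm
  have hm₁ : ∀ p : ℕ, p.Prime → p ∣ m₁ → p ∣ k := fun p hp hpm => by
    rw [hc₁] at hpm
    obtain ⟨q, hq, hpq⟩ := (Prime.dvd_finsetProd_iff hp.prime _).mp hpm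
    rw [Finset.mem_filter] at hq
    rw [(Nat.prime_dvd_prime_iff_eq hp (hsp q hq.1)).mp (hp.dvd_of_dvd_pow hpq)]
    exact hq.2
  have hm₂ : Nat.Coprime m₂ k := hc₂ ▸ Nat.Coprime.prod_left fun p hp => by
    rw [Finset.mem_filter] at hp
    exact Nat.Coprime.pow_left _ (((hsp p hp.1).coprime_iff_not_dvd).mpr hp.2)
  have hkw : (k : ℕ) ∣ twistLevel k t := Dvd.intro _ (coe_twistLevel k t).symm
  have hwk : (twistLevel k t : ℕ).primeFactors = (k : ℕ).primeFactors := by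
    refine (Nat.primeFactors_mono hkw (twistLevel k t).ne_zero).antisymm' fun p hp => ?_
    have hpp := Nat.prime_of_mem_primeFactors hp
    refine Nat.mem_primeFactors.mpr ⟨hpp, ?_, k.ne_zero⟩
    have hd := Nat.dvd_of_mem_primeFactors hp
    rw [coe_twistLevel, hpp.dvd_mul] at hd
    rcases hd with hd | hd
    · exact hd
    · obtain ⟨q, hq, hpq⟩ := (Prime.dvd_finsetProd_iff hpp.prime _).mp hd
      rw [(Nat.prime_dvd_prime_iff_eq hpp (Nat.prime_of_mem_primeFactors hq)).mp
        (hpp.dvd_of_dvd_pow hpq)]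
      exact Nat.dvd_of_mem_primeFactors hq
  have hw : (twistLevel k t : ℕ) ∣ m₁ := by
    refine (Nat.dvd_prod_primeFactors_pow_self (twistLevel k t).ne_zero).trans ?_
    rw [← Finset.prod_pow, hwk, hc₁]
    refine (Finset.prod_dvd_prod_of_dvd _ (fun p => p ^ n) fun p _ => pow_dvd_pow p hn).trans
      (Finset.prod_dvd_prod_of_subset _ _ _ fun p hp => ?_)
    have hpk := Nat.dvd_of_mem_primeFactors hp
    have hpn : p ≤ n := (Nat.le_of_dvd (twistLevel k t).pos (hpk.trans hkw)).trans hn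
    exact Finset.mem_filter.mpr ⟨Finset.mem_filter.mpr ⟨Finset.mem_range.mpr (by omega),
      Nat.prime_of_mem_primeFactors hp⟩, hpk⟩
  rw [hm, hk.Ffun_mul hg hm₁ hm₂, hk.Ffun_eq hg ht hw fun p hp => Nat.mem_primeFactors.mpr
    ⟨Nat.prime_of_mem_primeFactors hp, hm₁ p (Nat.prime_of_mem_primeFactors hp)
      (Nat.dvd_of_mem_primeFactors hp), k.ne_zero⟩]
  congr 1
  refine (Hfun_prod _ (fun p hp => hsp p (Finset.mem_filter.mp hp).1) n).trans
    (Finset.prod_congr rfl fun p hp => Hfun_prime_pow ht (hsp p (Finset.mem_filter.mp hp).1) ?_)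
  exact (Nat.add_le_add_right (Nat.padicValNat_le_self t.natAbs) 1).trans hnt

end TateBasis

end Limit

theorem lemma2p5
    (A : Over (Spec (.of ℚ))) [GrpObj A] [IsProper A.hom] [GeometricallyIntegral A.hom]
    (g : ℕ) (hg : 1 ≤ g) (hdim : topologicalKrullDim A.left = g)
    (b : TateBasis A g) (hopen : b.HasOpenImage) :
    ∃ mA : ℕ+, IsLeast {m : ℕ+ | b.IsLevel m} mA ∧
      -- splitting of the image at coprime levels
      (∀ m₁ m₂ : ℕ+, (∀ p : ℕ, p.Prime → p ∣ m₁ → p ∣ mA) → Nat.Coprime m₂ mA →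
        (∃ e : b.G (m₁ * m₂) ≃* b.G m₁ × b.G m₂, ∀ M : b.G (m₁ * m₂),
          ((e M).1 : GL (Fin g ⊕ Fin g) (ZMod (m₁ : ℕ))) =
            Matrix.GeneralLinearGroup.map
              (ZMod.castHom (PNat.mul_coe m₁ m₂ ▸ Nat.dvd_mul_right _ _) (ZMod (m₁ : ℕ))) M.1 ∧
          ((e M).2 : GL (Fin g ⊕ Fin g) (ZMod (m₂ : ℕ))) =
            Matrix.GeneralLinearGroup.map
              (ZMod.castHom (PNat.mul_coe m₁ m₂ ▸ Nat.dvd_mul_left _ _) (ZMod (m₂ : ℕ))) M.1) ∧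
        b.G m₂ = GSp g (ZMod (m₂ : ℕ))) ∧
      -- convergence of the infinite products, to a positive limit
      (∀ t : ℤ, Multipliable (fun ℓ : Nat.Primes => Hfun g t ℓ) ∧
        0 < ∏' ℓ : Nat.Primes, Hfun g t ℓ) ∧
      (∀ t : ℤ, t ≠ 0 →
        Multipliable (fun ℓ : {ℓ : Nat.Primes // ¬ (ℓ : ℕ) ∣ mA} =>
          Hfun g t ((ℓ : ℕ) ^ (padicValInt ℓ t + 1))) ∧
        0 < ∏' ℓ : {ℓ : Nat.Primes // ¬ (ℓ : ℕ) ∣ mA},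
          Hfun g t ((ℓ : ℕ) ^ (padicValInt ℓ t + 1))) ∧
      -- the limit along the sequence `mSeq`
      (∀ t : ℤ, t ≠ 0 →
        Filter.Tendsto (fun n : ℕ => b.Ffun t (mSeq n)) Filter.atTop
          (nhds (b.Ffun t (twistLevel mA t) *
            ∏' ℓ : {ℓ : Nat.Primes // ¬ (ℓ : ℕ) ∣ mA},
              Hfun g t ((ℓ : ℕ) ^ (padicValInt ℓ t + 1))))) := by

  obtain ⟨k, hk⟩ := hopen.exists_isLevel
  obtain ⟨mA, hmA, hmin⟩ := WellFounded.has_min (wellFounded_lt (α := ℕ+)) {m | b.IsLevel m} ⟨k, hk⟩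
  have hlevel : b.IsLevel mA := hmA
  have hpow : ∀ t : ℤ, t ≠ 0 →
      Multipliable (fun ℓ : {ℓ : Nat.Primes // ¬ (ℓ : ℕ) ∣ mA} =>
        Hfun g t ((ℓ : ℕ) ^ (padicValInt ℓ t + 1))) ∧
      0 < ∏' ℓ : {ℓ : Nat.Primes // ¬ (ℓ : ℕ) ∣ mA},
        Hfun g t ((ℓ : ℕ) ^ (padicValInt ℓ t + 1)) := fun t ht =>
    Real.multipliable_and_tprod_pos
      (fun ℓ => Hfun_pos hg t (pow_ne_zero _ ℓ.1.2.ne_zero))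
      ((summable_Hfun_pow_sub_one hg ht).comp_injective Subtype.val_injective)
  refine ⟨mA, ⟨hmA, fun m hm => not_lt.mp (hmin m hm)⟩, fun m₁ m₂ h₁ h₂ => ⟨?_, ?_⟩, fun t => ?_,
    hpow, fun t ht => ?_⟩
  · obtain ⟨hc, hsurj⟩ := hlevel.exists_mem_G_mul hg h₁ h₂
    exact exists_mulEquiv_prod_of_coprime hc (PNat.mul_coe m₁ m₂) _ _ _ _ _
      (fun _ h => TateBasis.map_castHom_mem_G _ h) (fun _ h => TateBasis.map_castHom_mem_G _ h) hsurj
  · exact hlevel.G_eq_GSp hg h₂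
  · exact Real.multipliable_and_tprod_pos (fun ℓ => Hfun_pos hg t ℓ.2.ne_zero)
      (summable_Hfun_sub_one hg t)
  · refine ((tendsto_prod_primes_not_dvd (f := fun p => Hfun g t (p ^ (padicValInt p t + 1)))
      (hpow t ht).1).const_mul (b.Ffun t (twistLevel mA t))).congr' ?_
    filter_upwards [Filter.eventually_ge_atTop (twistLevel mA t : ℕ),
      Filter.eventually_ge_atTop (t.natAbs + 1)] with n hn hnt
    exact (hlevel.Ffun_mSeq_eq hg ht hn hnt).symm
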